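/- Let $X$ be a fixed real $n\times d$ matrix without zero columns, put $\mathbb{X} := X^\top X$, and consider the linear regression model $\mathbf{Y} = X\beta_\star + \varepsilon$ with $\beta_\star\in\mathbb{R}^d$, $\mathbb{E}[\varepsilon]=0$ and $\mathrm{Cov}(\varepsilon)=I_n$. For a $d\times d$ matrix $A$ let $\mathrm{Diag}(A)$ be the diagonal matrix with the same main diagonal as $A$, and for $p\in(0,1)$ let $A_p := pA+(1-p)\mathrm{Diag}(A)$. Write $\|\cdot\|$ for the spectral norm and $\lambda_{\min}$ for the smallest eigenvalue of a symmetric matrix. A $p$-dropout matrix is a random diagonal $d\times d$ matrix whose diagonal entries are i.i.d. $\mathrm{Ber}(p)$ (equal to $1$ with probability $p$ and to $0$ otherwise). Let $\tilde\beta_0$ be a square integrable random vector in $\mathbb{R}^d$ that is independent of $\mathbf{Y}$, and let $D_1, D_2,\ldots$ be i.i.d. $p$-dropout matrices, independent of $(\mathbf{Y},\tilde\beta_0)$. For a learning rate $\alpha>0$, gradient descent with dropout is given by $$\tilde\beta_{k} = \tilde\beta_{k-1} + \alpha D_{k} X^\top\big(\mathbf{Y} - X D_{k}\tilde\beta_{k-1}\big),\qquad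 k=1,2,\ldots$$ Let $\tilde\beta := \operatorname{argmin}_{\beta\in\mathbb{R}^d}\mathbb{E}\big[\|\mathbf{Y}-XD\beta\|_2^2 \mid \mathbf{Y}\big]$, where $D$ is a $p$-dropout matrix independent of $\mathbf{Y}$. Then there are constants $C'$ and $C''$, depending only on $X$, $\beta_\star$ and the distributions of $\varepsilon$ and $\tilde\beta_0$, and in particular not on $(\alpha,p,k)$, such that for all $\alpha>0$ and $p\in(0,1)$ with $$\alpha p\|\mathbb{X}\|<1\qquad\text{and}\qquad \alpha<\frac{\lambda_{\min}(\mathbb{X}_p)}{3\|\mathbb{X}\|^2}$$ and all $k=1,2,\ldots$, $$\big\|\mathrm{Cov}(\tilde\beta_k)-\mathrm{Cov}(\tilde\beta)\big\| \le \frac{k\,\|I-\alpha p\mathbb{X}_p\|^{k-1}C'+\alpha p\,C''}{(1-p)^2}$$ and $$\big\|\mathrm{Cov}(\tilde\beta_k)-\mathrm{Diag}(\mathbb{X})^{-1}\mathbb{X}\,\mathrm{Diag}(\mathbb{X})^{-1}\big\| \le \frac{k\,\|I-\alpha p\mathbb{X}_p\|^{k-1}C'+p(1+\alpha)\,C''}{(1-p)^2}.$$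 -/

import Mathlib

open MeasureTheory ProbabilityTheory
open scoped Matrix Matrix.Norms.L2Operator

namespace Dropout

noncomputable section

/-- The Gram matrix `Xᵀ X` of the design matrix. -/
def gram {n d : ℕ} (X : Matrix (Fin n) (Fin d) ℝ) : Matrix (Fin d) (Fin d) ℝ :=
  Xᵀ * X

/-- `Diag(A)`: the diagonal matrix with the same main diagonal as `A`. -/
def diagPart {d : ℕ} (A : Matrix (Fin d) (Fin d) ℝ) : Matrix (Fin d) (Fin d) ℝ :=
  Matrix.diagonal A.diag

/-- `A_p = p A + (1 - p) Diag(A)`. -/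
def offDiagScale {d : ℕ} (p : ℝ) (A : Matrix (Fin d) (Fin d) ℝ) : Matrix (Fin d) (Fin d) ℝ :=
  p • A + (1 - p) • diagPart A

/-- The smallest eigenvalue of a symmetric matrix. -/
def lambdaMin {d : ℕ} (A : Matrix (Fin d) (Fin d) ℝ) : ℝ :=
  sInf (spectrum ℝ A)

/-- The covariance matrix of a random vector. -/
def covMatrix {Ω : Type*} [MeasurableSpace Ω] {m : ℕ} (Z : Ω → Fin m → ℝ) (μ : Measure Ω) :
    Matrix (Fin m) (Fin m) ℝ :=
  Matrix.of fun i j => covariance (fun ω => Z ω i) (fun ω => Z ω j) μ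

/-- The law of the diagonal of a `p`-dropout matrix: `d` independent `Ber(p)` entries.
A dropout matrix is `Matrix.diagonal δ` for a random vector `δ` with this law. -/
def dropoutLaw (d : ℕ) (p : unitInterval) : Measure (Fin d → ℝ) :=
  Measure.pi fun _ => bernoulliMeasure (1 : ℝ) 0 p

/-- The loss `E[‖Y - X D b‖₂² | Y = y]`, with the noise of the dropout matrix `D`
(which is independent of `Y`) integrated out. -/
def marginalizedLoss {n d : ℕ} (X : Matrix (Fin n) (Fin d) ℝ) (p : unitInterval)
    (y : Fin n → ℝ) (b : Fin d → ℝ) : ℝ :=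
  ∫ δ, ‖WithLp.toLp 2 (y - (X * Matrix.diagonal δ) *ᵥ b)‖ ^ 2 ∂(dropoutLaw d p)

/-- The estimator `y ↦ b y` minimizes the marginalized loss. -/
def IsMarginalizedLossMinimizer {n d : ℕ} (X : Matrix (Fin n) (Fin d) ℝ) (p : unitInterval)
    (b : (Fin n → ℝ) → (Fin d → ℝ)) : Prop :=
  ∀ y, IsMinOn (marginalizedLoss X p y) Set.univ (b y)

/-- Gradient descent with dropout: the `(k + 1)`-st step uses the dropout matrix
`D = Matrix.diagonal (δ k)` and maps `b` to
`b - α ∇_b (1/2) ‖y - X D b‖₂² = b + α D Xᵀ (y - X D b)`. -/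
def dropoutIterate {n d : ℕ} (X : Matrix (Fin n) (Fin d) ℝ) (α : ℝ)
    (y : Fin n → ℝ) (b₀ : Fin d → ℝ) (δ : ℕ → Fin d → ℝ) : ℕ → Fin d → ℝ
  | 0 => b₀
  | k + 1 =>
    let b := dropoutIterate X α y b₀ δ k
    let D := Matrix.diagonal (δ k)
    b + α • ((D * Xᵀ) *ᵥ (y - (X * D) *ᵥ b))

end

end Dropout

/-!
Write `G = Xᵀ X` and let `β̃` be the minimizer. Since `D² = D` almost surely and `G_p β̃ = Xᵀ Y`,
the error `U_k = β̃_k - β̃` satisfies the affine recursion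
`U_k = (1 - α D G D) U_{k-1} + α D (G - Diag(G)) (p - D) β̃`.
The forcing term is centred given `β̃`, and `E[1 - α D G D] = 1 - α p G_p`, so
`Cov(U_k, β̃) = (1 - α p G_p)^k Cov(U_0, β̃)`. The second moment `E|U_k|²` is contracted by the
factor `1 - α p λ_min(G_p) ≤ ‖1 - α p G_p‖` in each step, up to a cross term of order
`‖1 - α p G_p‖^k` and a forcing term of order `α² p² (1 - p) E|β̃|²`. As
`λ_min(G_p) ≥ (1 - p) min_i G_ii`, the forcing terms sum up to `O(α p E|β̃|²)`, and the same bound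
on `λ_min(G_p)` makes `E|β̃|²` of order `(1 - p)⁻²`. The second estimate compares `β̃` with
`Diag(G)⁻¹ Xᵀ Y = (1 + p Diag(G)⁻¹ (G - Diag(G))) β̃`, whose covariance is
`Diag(G)⁻¹ G Diag(G)⁻¹`.
-/

namespace Dropout

section LinearAlgebra

variable {m n : Type*} [Fintype m] [Fintype n]

lemma dotProduct_self_eq_norm_sq (u : n → ℝ) : u ⬝ᵥ u = ‖WithLp.toLp 2 u‖ ^ 2 := by
  rw [EuclideanSpace.real_norm_sq_eq]
  simp only [dotProduct, sq]

lemma dotProduct_self_nonneg (u : n → ℝ) : 0 ≤ u ⬝ᵥ u := by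
  rw [dotProduct_self_eq_norm_sq]; positivity

lemma add_dotProduct_add_self (u v : n → ℝ) :
    (u + v) ⬝ᵥ (u + v) = u ⬝ᵥ u + 2 * (u ⬝ᵥ v) + v ⬝ᵥ v := by
  rw [add_dotProduct, dotProduct_add, dotProduct_add, dotProduct_comm v u]; ring

lemma two_mul_abs_dotProduct_le (u v : n → ℝ) : 2 * |u ⬝ᵥ v| ≤ u ⬝ᵥ u + v ⬝ᵥ v := by
  have h₁ := dotProduct_self_nonneg (u + v)
  have h₂ := dotProduct_self_nonneg (u - v)
  rw [add_dotProduct_add_self] at h₁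
  rw [sub_eq_add_neg, add_dotProduct_add_self] at h₂
  simp only [dotProduct_neg, neg_dotProduct, neg_neg] at h₂
  cases abs_cases (u ⬝ᵥ v) <;> linarith

lemma sub_dotProduct_sub_self_le (u v : n → ℝ) :
    (u - v) ⬝ᵥ (u - v) ≤ 2 * (u ⬝ᵥ u) + 2 * (v ⬝ᵥ v) := by
  have h := two_mul_abs_dotProduct_le u v
  have h' := neg_abs_le (u ⬝ᵥ v)
  rw [sub_eq_add_neg, add_dotProduct_add_self]
  simp only [dotProduct_neg, neg_dotProduct, neg_neg]
  linarith

lemma dotProduct_mulVec_eq_sum (A : Matrix m n ℝ) (w : m → ℝ) (u : n → ℝ) :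
    w ⬝ᵥ (A *ᵥ u) = ∑ i, ∑ j, A i j * (w i * u j) := by
  simp only [dotProduct, Matrix.mulVec, Finset.mul_sum]
  exact Finset.sum_congr rfl fun i _ => Finset.sum_congr rfl fun j _ => by ring

lemma dotProduct_transpose_mul_mulVec {k : Type*} (A : Matrix m k ℝ) (B : Matrix m n ℝ) [Fintype k]
    (w : k → ℝ) (u : n → ℝ) : w ⬝ᵥ ((Aᵀ * B) *ᵥ u) = (A *ᵥ w) ⬝ᵥ (B *ᵥ u) := by
  rw [← Matrix.mulVec_mulVec, Matrix.dotProduct_mulVec, Matrix.vecMul_transpose]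

variable [DecidableEq n]

lemma norm_toLp_mulVec_le (A : Matrix m n ℝ) (u : n → ℝ) :
    ‖WithLp.toLp 2 (A *ᵥ u)‖ ≤ ‖A‖ * ‖WithLp.toLp 2 u‖ := by
  simpa using A.l2_opNorm_mulVec (WithLp.toLp 2 u)

lemma abs_dotProduct_mulVec_le_norm_mul (A : Matrix m n ℝ) (w : m → ℝ) (u : n → ℝ) :
    |w ⬝ᵥ (A *ᵥ u)| ≤ ‖A‖ * ‖WithLp.toLp 2 w‖ * ‖WithLp.toLp 2 u‖ := by
  have h := abs_real_inner_le_norm (WithLp.toLp 2 (A *ᵥ u)) (WithLp.toLp 2 w)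
  rw [EuclideanSpace.inner_toLp_toLp, star_trivial] at h
  nlinarith [norm_toLp_mulVec_le A u, norm_nonneg (WithLp.toLp 2 w)]

lemma norm_le_of_forall_two_mul_abs_dotProduct_mulVec_le {A : Matrix m n ℝ} {c : ℝ} (hc : 0 ≤ c)
    (h : ∀ w u, 2 * |w ⬝ᵥ (A *ᵥ u)| ≤ c * (w ⬝ᵥ w + u ⬝ᵥ u)) : ‖A‖ ≤ c := by
  rw [Matrix.l2_opNorm_def]
  refine ContinuousLinearMap.opNorm_le_bound _ hc fun x => ?_
  change ‖WithLp.toLp 2 (A *ᵥ x.ofLp)‖ ≤ c * ‖x‖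
  have hx := h (A *ᵥ x.ofLp) (c • x.ofLp)
  simp only [Matrix.mulVec_smul, dotProduct_smul, smul_dotProduct, smul_eq_mul,
    dotProduct_self_eq_norm_sq, WithLp.toLp_ofLp] at hx
  rw [abs_of_nonneg (by positivity)] at hx
  rcases hc.eq_or_lt with rfl | hc
  · have h₀ := h (A *ᵥ x.ofLp) x.ofLp
    rw [dotProduct_self_eq_norm_sq, abs_of_nonneg (by positivity)] at h₀
    nlinarith [norm_nonneg (WithLp.toLp 2 (A *ᵥ x.ofLp))]
  · refine le_of_sq_le_sq ?_ (by positivity)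
    nlinarith

lemma two_mul_abs_dotProduct_mulVec_le (A : Matrix n n ℝ) (w u : n → ℝ) :
    2 * |w ⬝ᵥ (A *ᵥ u)| ≤ ‖A‖ * (w ⬝ᵥ w + u ⬝ᵥ u) := by
  rw [dotProduct_self_eq_norm_sq, dotProduct_self_eq_norm_sq]
  nlinarith [abs_dotProduct_mulVec_le_norm_mul A w u,
    mul_nonneg (norm_nonneg A) (sq_nonneg (‖WithLp.toLp 2 w‖ - ‖WithLp.toLp 2 u‖))]

lemma mulVec_dotProduct_mulVec_self_le (A : Matrix m n ℝ) (u : n → ℝ) :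
    (A *ᵥ u) ⬝ᵥ (A *ᵥ u) ≤ ‖A‖ ^ 2 * (u ⬝ᵥ u) := by
  rw [dotProduct_self_eq_norm_sq, dotProduct_self_eq_norm_sq, ← mul_pow]
  gcongr
  exact norm_toLp_mulVec_le A u

lemma abs_apply_le_norm (A : Matrix m n ℝ) (i : m) (j : n) : |A i j| ≤ ‖A‖ := by
  classical
  simpa using abs_dotProduct_mulVec_le_norm_mul A (Pi.single i 1) (Pi.single j 1)

lemma norm_transpose (A : Matrix m n ℝ) [DecidableEq m] : ‖Aᵀ‖ = ‖A‖ := by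
  rw [← Matrix.conjTranspose_eq_transpose_of_trivial, Matrix.l2_opNorm_conjTranspose]

lemma norm_matrix_pow_le (A : Matrix n n ℝ) (k : ℕ) : ‖A ^ k‖ ≤ ‖A‖ ^ k := by
  cases isEmpty_or_nonempty n
  · rw [Subsingleton.elim (A ^ k) 0, norm_zero]
    positivity
  · exact norm_pow_le A k

lemma norm_one_add_smul_mul_mul_transpose_sub_le {p : ℝ} (hp₀ : 0 ≤ p) (hp₁ : p ≤ 1)
    (Z K : Matrix n n ℝ) :
    ‖(1 + p • Z) * K * (1 + p • Z)ᵀ - K‖ ≤ p * (2 * ‖Z‖ + ‖Z‖ ^ 2) * ‖K‖ := by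
  have h : (1 + p • Z) * K * (1 + p • Z)ᵀ - K
      = p • (Z * K) + p • (K * Zᵀ) + p • p • (Z * K * Zᵀ) := by
    simp only [Matrix.transpose_add, Matrix.transpose_one, Matrix.transpose_smul, add_mul, mul_add,
      one_mul, mul_one, Matrix.smul_mul, Matrix.mul_smul]
    abel
  have h₁ : ‖Z * K‖ ≤ ‖Z‖ * ‖K‖ := norm_mul_le _ _
  have h₂ : ‖K * Zᵀ‖ ≤ ‖Z‖ * ‖K‖ := by
    simpa only [norm_transpose, mul_comm] using norm_mul_le K Zᵀ
  have h₃ : ‖Z * K * Zᵀ‖ ≤ ‖Z‖ * ‖K‖ * ‖Z‖ := by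
    simpa only [norm_transpose] using (norm_mul_le _ _).trans
      (mul_le_mul_of_nonneg_right h₁ (norm_nonneg Zᵀ))
  rw [h]
  calc _ ≤ p * ‖Z * K‖ + p * ‖K * Zᵀ‖ + p * (p * ‖Z * K * Zᵀ‖) := by
        refine norm_add₃_le.trans (le_of_eq ?_)
        simp only [norm_smul, Real.norm_of_nonneg hp₀]
    _ ≤ p * (‖Z‖ * ‖K‖) + p * (‖Z‖ * ‖K‖) + p * (1 * (‖Z‖ * ‖K‖ * ‖Z‖)) := by gcongr
    _ = p * (2 * ‖Z‖ + ‖Z‖ ^ 2) * ‖K‖ := by ring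

end LinearAlgebra

noncomputable section RandomVectors

variable {Ω : Type*} [MeasurableSpace Ω] {μ : Measure Ω} {m n : Type*}

/-- The matrix `Cov(U, W)` of covariances between the coordinates of two random vectors;
`covMatrix Z μ` is `crossCov Z Z μ`. -/
def crossCov (U : Ω → m → ℝ) (W : Ω → n → ℝ) (μ : Measure Ω) : Matrix m n ℝ :=
  Matrix.of fun i j => cov[fun ω => U ω i, fun ω => W ω j; μ]

lemma crossCov_transpose (U : Ω → m → ℝ) (W : Ω → n → ℝ) :
    (crossCov U W μ)ᵀ = crossCov W U μ := by
  ext i j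
  exact covariance_comm _ _

lemma crossCov_congr_left {U U' : Ω → m → ℝ} (h : U =ᵐ[μ] U') (W : Ω → n → ℝ) :
    crossCov U W μ = crossCov U' W μ := by
  ext i j
  have hi : (fun ω => U ω i) =ᵐ[μ] fun ω => U' ω i := h.mono fun ω hω => congrFun hω i
  simp only [crossCov, Matrix.of_apply, covariance]
  rw [integral_congr_ae hi]
  exact integral_congr_ae (hi.mono fun ω hω => by simp only [hω])

variable [Fintype m] [Fintype n]

lemma memLp_mulVec {q : ENNReal} (A : Matrix m n ℝ) {U : Ω → n → ℝ} (hU : MemLp U q μ) :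
    MemLp (fun ω => A *ᵥ U ω) q μ :=
  (Matrix.mulVecLin A).toContinuousLinearMap.comp_memLp' hU

lemma integrable_dotProduct {U W : Ω → n → ℝ} (hU : MemLp U 2 μ) (hW : MemLp W 2 μ) :
    Integrable (fun ω => U ω ⬝ᵥ W ω) μ :=
  integrable_finsetSum _ fun i _ => (hU.eval i).integrable_mul (hW.eval i)

lemma integral_dotProduct {U W : Ω → n → ℝ} (hU : MemLp U 2 μ) (hW : MemLp W 2 μ) :
    ∫ ω, U ω ⬝ᵥ W ω ∂μ = ∑ i, ∫ ω, U ω i * W ω i ∂μ :=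
  integral_finsetSum _ fun i _ => (hU.eval i).integrable_mul (hW.eval i)

lemma integral_add_dotProduct_add_self {U W : Ω → n → ℝ} (hU : MemLp U 2 μ) (hW : MemLp W 2 μ) :
    ∫ ω, (U ω + W ω) ⬝ᵥ (U ω + W ω) ∂μ
      = ∫ ω, U ω ⬝ᵥ U ω ∂μ + 2 * ∫ ω, U ω ⬝ᵥ W ω ∂μ + ∫ ω, W ω ⬝ᵥ W ω ∂μ := by
  have hUW := (integrable_dotProduct hU hW).const_mul 2
  have hUU_UW : Integrable (fun ω => U ω ⬝ᵥ U ω + 2 * (U ω ⬝ᵥ W ω)) μ :=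
    (integrable_dotProduct hU hU).add hUW
  simp only [add_dotProduct_add_self]
  rw [integral_add hUU_UW (integrable_dotProduct hW hW),
    integral_add (integrable_dotProduct hU hU) hUW, integral_const_mul]

lemma integral_sub_dotProduct_sub_self_le {U W : Ω → n → ℝ} (hU : MemLp U 2 μ)
    (hW : MemLp W 2 μ) :
    ∫ ω, (U ω - W ω) ⬝ᵥ (U ω - W ω) ∂μ
      ≤ 2 * ∫ ω, U ω ⬝ᵥ U ω ∂μ + 2 * ∫ ω, W ω ⬝ᵥ W ω ∂μ := by
  have hUU := (integrable_dotProduct hU hU).const_mul 2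
  have hWW := (integrable_dotProduct hW hW).const_mul 2
  rw [← integral_const_mul, ← integral_const_mul, ← integral_add hUU hWW]
  exact integral_mono (integrable_dotProduct (hU.sub hW) (hU.sub hW)) (hUU.add hWW)
    fun ω => sub_dotProduct_sub_self_le (U ω) (W ω)

lemma integral_dotProduct_self_nonneg (U : Ω → n → ℝ) : 0 ≤ ∫ ω, U ω ⬝ᵥ U ω ∂μ :=
  integral_nonneg fun ω => dotProduct_self_nonneg (U ω)

lemma two_mul_integral_dotProduct_mulVec_le [DecidableEq n] (A : Matrix n n ℝ) {U W : Ω → n → ℝ}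
    (hW : MemLp W 2 μ) (hU : MemLp U 2 μ) :
    2 * ∫ ω, W ω ⬝ᵥ (A *ᵥ U ω) ∂μ
      ≤ ‖A‖ * (∫ ω, W ω ⬝ᵥ W ω ∂μ + ∫ ω, U ω ⬝ᵥ U ω ∂μ) := by
  rw [← integral_const_mul, ← integral_add (integrable_dotProduct hW hW)
    (integrable_dotProduct hU hU), ← integral_const_mul]
  refine integral_mono ((integrable_dotProduct hW (memLp_mulVec A hU)).const_mul 2)
    (((integrable_dotProduct hW hW).add (integrable_dotProduct hU hU)).const_mul _) fun ω => ?_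
  have h := two_mul_abs_dotProduct_mulVec_le A (W ω) (U ω)
  have h' := le_abs_self (W ω ⬝ᵥ (A *ᵥ U ω))
  dsimp only
  linarith

lemma memLp_dotProduct {q : ENNReal} {U : Ω → n → ℝ} (hU : MemLp U q μ) (w : n → ℝ) :
    MemLp (fun ω => w ⬝ᵥ U ω) q μ :=
  memLp_finsetSum _ fun i _ => (hU.eval i).const_mul (w i)

lemma variance_dotProduct_le [IsProbabilityMeasure μ] {U : Ω → n → ℝ} (hU : MemLp U 2 μ)
    (w : n → ℝ) : Var[fun ω => w ⬝ᵥ U ω; μ] ≤ (w ⬝ᵥ w) * ∫ ω, U ω ⬝ᵥ U ω ∂μ := by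
  refine (variance_le_expectation_sq (memLp_dotProduct hU w).aestronglyMeasurable).trans ?_
  rw [← integral_const_mul]
  refine integral_mono (memLp_dotProduct hU w).integrable_sq
    ((integrable_dotProduct hU hU).const_mul _) fun ω => ?_
  simpa only [dotProduct, Pi.pow_apply, ← sq] using
    Finset.sum_mul_sq_le_sq_mul_sq Finset.univ w (U ω)

section Linear

variable [IsProbabilityMeasure μ] {U U' : Ω → m → ℝ} {W W' : Ω → n → ℝ}

lemma crossCov_add_left (hU : MemLp U 2 μ) (hU' : MemLp U' 2 μ) (hW : MemLp W 2 μ) :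
    crossCov (fun ω => U ω + U' ω) W μ = crossCov U W μ + crossCov U' W μ := by
  ext i j
  exact covariance_add_left (hU.eval i) (hU'.eval i) (hW.eval j)

lemma crossCov_add_right (hU : MemLp U 2 μ) (hW : MemLp W 2 μ) (hW' : MemLp W' 2 μ) :
    crossCov U (fun ω => W ω + W' ω) μ = crossCov U W μ + crossCov U W' μ := by
  ext i j
  exact covariance_add_right (hU.eval i) (hW.eval j) (hW'.eval j)

lemma crossCov_mulVec_left {k : Type*} (A : Matrix k m ℝ) (hU : MemLp U 2 μ) (hW : MemLp W 2 μ) :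
    crossCov (fun ω => A *ᵥ U ω) W μ = A * crossCov U W μ := by
  ext i j
  refine (covariance_fun_sum_left (fun l => (hU.eval l).const_mul (A i l)) (hW.eval j)).trans ?_
  simp only [Matrix.mul_apply, crossCov, Matrix.of_apply, covariance_const_mul_left]

lemma crossCov_mulVec_self {k : Type*} [Finite k] (A : Matrix k m ℝ) (hU : MemLp U 2 μ) :
    crossCov (fun ω => A *ᵥ U ω) (fun ω => A *ᵥ U ω) μ = A * crossCov U U μ * Aᵀ := by
  cases nonempty_fintype k
  rw [crossCov_mulVec_left A hU (memLp_mulVec A hU), ← crossCov_transpose,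
    crossCov_mulVec_left A hU hU, Matrix.transpose_mul, crossCov_transpose, Matrix.mul_assoc]

lemma crossCov_const_add_self (c : m → ℝ) (hU : MemLp U 2 μ) :
    crossCov (fun ω => c + U ω) (fun ω => c + U ω) μ = crossCov U U μ := by
  ext i j
  have hi := (hU.eval i).integrable one_le_two
  have hj := (hU.eval j).integrable one_le_two
  exact (covariance_const_add_left hi (c i)).trans (covariance_const_add_right hj (c j))

lemma dotProduct_crossCov_mulVec (hU : MemLp U 2 μ) (hW : MemLp W 2 μ) (u : m → ℝ) (w : n → ℝ) :
    u ⬝ᵥ (crossCov U W μ *ᵥ w) = cov[fun ω => u ⬝ᵥ U ω, fun ω => w ⬝ᵥ W ω; μ] := by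
  simp only [dotProduct]
  rw [covariance_fun_sum_fun_sum (fun i => (hU.eval i).const_mul (u i))
    fun j => (hW.eval j).const_mul (w j)]
  simp only [Matrix.mulVec, dotProduct, Finset.mul_sum, crossCov, Matrix.of_apply,
    covariance_const_mul_left, covariance_const_mul_right]
  exact Finset.sum_congr rfl fun i _ => Finset.sum_congr rfl fun j _ => by ring

lemma two_mul_abs_covariance_le {f g : Ω → ℝ} (hf : MemLp f 2 μ) (hg : MemLp g 2 μ) :
    2 * |cov[f, g; μ]| ≤ Var[f; μ] + Var[g; μ] := by
  have hadd := variance_nonneg (f + g) μ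
  have hsub := variance_nonneg (f - g) μ
  rw [variance_add hf hg] at hadd
  rw [variance_sub hf hg] at hsub
  cases abs_cases cov[f, g; μ] <;> linarith

lemma norm_crossCov_le [DecidableEq n] {c : ℝ} (hU : MemLp U 2 μ) (hW : MemLp W 2 μ)
    (hUc : ∫ ω, U ω ⬝ᵥ U ω ∂μ ≤ c) (hWc : ∫ ω, W ω ⬝ᵥ W ω ∂μ ≤ c) : ‖crossCov U W μ‖ ≤ c := by
  refine norm_le_of_forall_two_mul_abs_dotProduct_mulVec_le
    ((integral_dotProduct_self_nonneg U).trans hUc) fun u w => ?_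
  rw [dotProduct_crossCov_mulVec hU hW]
  calc _ ≤ Var[fun ω => u ⬝ᵥ U ω; μ] + Var[fun ω => w ⬝ᵥ W ω; μ] :=
        two_mul_abs_covariance_le (memLp_dotProduct hU u) (memLp_dotProduct hW w)
    _ ≤ (u ⬝ᵥ u) * c + (w ⬝ᵥ w) * c :=
        add_le_add
          ((variance_dotProduct_le hU u).trans
            (mul_le_mul_of_nonneg_left hUc (dotProduct_self_nonneg u)))
          ((variance_dotProduct_le hW w).trans
            (mul_le_mul_of_nonneg_left hWc (dotProduct_self_nonneg w)))
    _ = c * (u ⬝ᵥ u + w ⬝ᵥ w) := by ring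

lemma norm_crossCov_add_self_sub_le [DecidableEq m] (hU : MemLp U 2 μ) (hU' : MemLp U' 2 μ) :
    ‖crossCov (fun ω => U ω + U' ω) (fun ω => U ω + U' ω) μ - crossCov U' U' μ‖
      ≤ ∫ ω, U ω ⬝ᵥ U ω ∂μ + 2 * ‖crossCov U U' μ‖ := by
  have h : crossCov (fun ω => U ω + U' ω) (fun ω => U ω + U' ω) μ - crossCov U' U' μ
      = crossCov U U μ + crossCov U U' μ + (crossCov U U' μ)ᵀ := by
    have hadd : MemLp (fun ω => U ω + U' ω) 2 μ := hU.add hU'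
    rw [crossCov_add_left hU hU' hadd, crossCov_add_right hU hU hU',
      crossCov_add_right hU' hU hU', crossCov_transpose]
    abel
  rw [h]
  refine norm_add₃_le.trans ?_
  rw [norm_transpose]
  linarith [norm_crossCov_le hU hU le_rfl le_rfl]

end Linear

end RandomVectors

section Independence

variable {Ω S : Type*} [MeasurableSpace Ω] [MeasurableSpace S] {μ : Measure Ω} {ρ : Measure S}
variable {m n : Type*} [Fintype m] [Fintype n] [DecidableEq n]

lemma integral_matrix_apply {A : S → Matrix m n ℝ} (hA : Integrable A ρ) (i : m) (j : n) :
    (∫ s, A s ∂ρ) i j = ∫ s, A s i j ∂ρ :=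
  ((Matrix.entryLinearMap ℝ ℝ i j).toContinuousLinearMap.integral_comp_comm hA).symm

lemma integral_transpose [DecidableEq m] {A : S → Matrix m n ℝ} (hA : Integrable A ρ) :
    ∫ s, (A s)ᵀ ∂ρ = (∫ s, A s ∂ρ)ᵀ :=
  (Matrix.transposeLinearEquiv m n ℝ ℝ).toLinearMap.toContinuousLinearMap.integral_comp_comm hA

lemma dotProduct_integral_mulVec {A : S → Matrix m n ℝ} (hA : Integrable A ρ) (w : m → ℝ)
    (u : n → ℝ) : w ⬝ᵥ ((∫ s, A s ∂ρ) *ᵥ u) = ∫ s, w ⬝ᵥ (A s *ᵥ u) ∂ρ := by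
  simp only [dotProduct_mulVec_eq_sum, integral_matrix_apply hA]
  have hint (i j) : Integrable (fun s => A s i j * (w i * u j)) ρ :=
    ((Matrix.entryLinearMap ℝ ℝ i j).toContinuousLinearMap.integrable_comp hA).mul_const _
  rw [integral_finsetSum _ fun i _ => integrable_finsetSum _ fun j _ => hint i j]
  refine Finset.sum_congr rfl fun i _ => ?_
  rw [integral_finsetSum _ fun j _ => hint i j]
  exact Finset.sum_congr rfl fun j _ => (integral_mul_const _ _).symm

lemma memLp_matrix_apply {q : ENNReal} {A : S → Matrix m n ℝ} (hA : MemLp A q ρ) (i : m) (j : n) :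
    MemLp (fun s => A s i j) q ρ :=
  (Matrix.entryLinearMap ℝ ℝ i j).toContinuousLinearMap.comp_memLp' hA

lemma memLp_transpose [DecidableEq m] {q : ENNReal} {A : S → Matrix m n ℝ} (hA : MemLp A q ρ) :
    MemLp (fun s => (A s)ᵀ) q ρ :=
  (Matrix.transposeLinearEquiv m n ℝ ℝ).toLinearMap.toContinuousLinearMap.comp_memLp' hA

lemma memLp_transpose_mul {A B : S → Matrix n n ℝ} (hA : MemLp A ⊤ ρ) (hB : MemLp B ⊤ ρ) :
    MemLp (fun s => (A s)ᵀ * B s) ⊤ ρ :=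
  hB.mul' (memLp_transpose hA)

variable {δ : Ω → S} {A : S → Matrix m n ℝ} {U : Ω → n → ℝ}

lemma memLp_random_matrix_apply (hδ : HasLaw δ ρ μ) (hA : MemLp A ⊤ ρ) (i : m) (j : n) :
    MemLp (fun ω => A (δ ω) i j) ⊤ μ :=
  (hδ.map_eq.symm ▸ memLp_matrix_apply hA i j).comp_of_map hδ.aemeasurable

lemma memLp_random_mulVec (hδ : HasLaw δ ρ μ) (hA : MemLp A ⊤ ρ) (hU : MemLp U 2 μ) :
    MemLp (fun ω => A (δ ω) *ᵥ U ω) 2 μ :=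
  MemLp.of_eval fun i => memLp_finsetSum _ fun j _ =>
    (hU.eval j).mul' (memLp_random_matrix_apply hδ hA i j)

lemma indepFun_random_matrix_apply (hδ : HasLaw δ ρ μ) (hA : MemLp A ⊤ ρ) {f : Ω → ℝ}
    (hf : MemLp f 2 μ) (hU : MemLp U 2 μ) (hind : IndepFun δ (fun ω => (f ω, U ω)) μ)
    (i : m) (j : n) : IndepFun (fun ω => A (δ ω) i j) (fun ω => f ω * U ω j) μ := by
  have hAij : AEMeasurable (fun s => A s i j) (μ.map δ) :=
    hδ.map_eq ▸ (memLp_matrix_apply hA i j).aestronglyMeasurable.aemeasurable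
  have hfU : Measurable fun x : ℝ × (n → ℝ) => x.1 * x.2 j := by fun_prop
  exact hind.comp₀ hδ.aemeasurable
    (hf.aestronglyMeasurable.aemeasurable.prodMk hU.aestronglyMeasurable.aemeasurable)
    hAij hfU.aemeasurable

variable [IsProbabilityMeasure ρ]

lemma integral_mul_random_mulVec_apply (hδ : HasLaw δ ρ μ) (hA : MemLp A ⊤ ρ) {f : Ω → ℝ}
    (hf : MemLp f 2 μ) (hU : MemLp U 2 μ) (hind : IndepFun δ (fun ω => (f ω, U ω)) μ) (i : m) :
    ∫ ω, f ω * (A (δ ω) *ᵥ U ω) i ∂μ = ∫ ω, f ω * ((∫ s, A s ∂ρ) *ᵥ U ω) i ∂μ := by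
  have hfU j : Integrable (fun ω => f ω * U ω j) μ := hf.integrable_mul (hU.eval j)
  have hAij := memLp_random_matrix_apply hδ hA i
  have hprod j : Integrable (fun ω => A (δ ω) i j * (f ω * U ω j)) μ :=
    memLp_one_iff_integrable.1 ((memLp_one_iff_integrable.2 (hfU j)).mul' (hAij j))
  have hentry j : ∫ ω, A (δ ω) i j * (f ω * U ω j) ∂μ
      = ∫ ω, (∫ s, A s ∂ρ) i j * (f ω * U ω j) ∂μ := by
    rw [(indepFun_random_matrix_apply hδ hA hf hU hind i j).integral_fun_mul_eq_mul_integral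
      (hAij j).aestronglyMeasurable (hfU j).aestronglyMeasurable, integral_const_mul,
      integral_matrix_apply (hA.integrable le_top)]
    congr 1
    exact hδ.integral_comp (memLp_matrix_apply hA i j).aestronglyMeasurable
  simp only [Matrix.mulVec, dotProduct, Finset.mul_sum, mul_left_comm (f _)]
  rw [integral_finsetSum _ fun j _ => hprod j,
    integral_finsetSum _ fun j _ => (hfU j).const_mul _]
  exact Finset.sum_congr rfl fun j _ => hentry j

lemma integral_dotProduct_random_mulVec (hδ : HasLaw δ ρ μ) (hA : MemLp A ⊤ ρ) {W : Ω → m → ℝ}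
    (hW : MemLp W 2 μ) (hU : MemLp U 2 μ) (hind : IndepFun δ (fun ω => (W ω, U ω)) μ) :
    ∫ ω, W ω ⬝ᵥ (A (δ ω) *ᵥ U ω) ∂μ = ∫ ω, W ω ⬝ᵥ ((∫ s, A s ∂ρ) *ᵥ U ω) ∂μ := by
  have hWi (i : m) : Measurable fun x : (m → ℝ) × (n → ℝ) => (x.1 i, x.2) := by fun_prop
  rw [integral_dotProduct hW (memLp_random_mulVec hδ hA hU),
    integral_dotProduct hW (memLp_mulVec _ hU)]
  exact Finset.sum_congr rfl fun i _ => integral_mul_random_mulVec_apply hδ hA (hW.eval i) hU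
    (hind.comp measurable_id (hWi i)) i

lemma integral_random_mulVec_dotProduct_random_mulVec {A B : S → Matrix n n ℝ} {W : Ω → n → ℝ}
    (hδ : HasLaw δ ρ μ) (hA : MemLp A ⊤ ρ) (hB : MemLp B ⊤ ρ) (hW : MemLp W 2 μ)
    (hU : MemLp U 2 μ) (hind : IndepFun δ (fun ω => (W ω, U ω)) μ) :
    ∫ ω, (A (δ ω) *ᵥ W ω) ⬝ᵥ (B (δ ω) *ᵥ U ω) ∂μ
      = ∫ ω, W ω ⬝ᵥ ((∫ s, (A s)ᵀ * B s ∂ρ) *ᵥ U ω) ∂μ := by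
  rw [← integral_dotProduct_random_mulVec hδ (memLp_transpose_mul hA hB) hW hU hind]
  simp only [dotProduct_transpose_mul_mulVec]

lemma crossCov_random_mulVec_left [IsProbabilityMeasure μ] {k : Type*} [Fintype k]
    {V : Ω → k → ℝ} (hδ : HasLaw δ ρ μ) (hA : MemLp A ⊤ ρ) (hU : MemLp U 2 μ) (hV : MemLp V 2 μ)
    (hind : IndepFun δ (fun ω => (U ω, V ω)) μ) :
    crossCov (fun ω => A (δ ω) *ᵥ U ω) V μ = (∫ s, A s ∂ρ) * crossCov U V μ := by
  have hmean (i : m) : ∫ ω, (A (δ ω) *ᵥ U ω) i ∂μ = ∫ ω, ((∫ s, A s ∂ρ) *ᵥ U ω) i ∂μ := by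
    have hφ : Measurable fun x : (n → ℝ) × (k → ℝ) => ((1 : ℝ), x.1) := by fun_prop
    simpa only [one_mul] using integral_mul_random_mulVec_apply hδ hA (memLp_const 1) hU
      (hind.comp measurable_id hφ) i
  have hprod (i : m) (j : k) : ∫ ω, V ω j * (A (δ ω) *ᵥ U ω) i ∂μ
      = ∫ ω, V ω j * ((∫ s, A s ∂ρ) *ᵥ U ω) i ∂μ := by
    have hφ : Measurable fun x : (n → ℝ) × (k → ℝ) => (x.2 j, x.1) := by fun_prop
    exact integral_mul_random_mulVec_apply hδ hA (hV.eval j) hU (hind.comp measurable_id hφ) i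
  rw [← crossCov_mulVec_left _ hU hV]
  ext i j
  simp only [crossCov, Matrix.of_apply]
  rw [covariance_comm, covariance_eq_sub (hV.eval j) ((memLp_random_mulVec hδ hA hU).eval i),
    covariance_comm, covariance_eq_sub (hV.eval j) ((memLp_mulVec _ hU).eval i)]
  simp only [Pi.mul_apply, hprod, hmean]

end Independence

lemma le_of_affine_recursion {a : ℕ → ℝ} {r q c R : ℝ} (hr : 0 ≤ r) (hrq : r ≤ q) (hc : 0 ≤ c)
    (ha₀ : 0 ≤ a 0) (hR : 0 ≤ R) (h : ∀ k, a (k + 1) ≤ r * a k + q ^ k * c + (1 - r) * R) (k : ℕ) :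
    a k ≤ q ^ k * a 0 + k * q ^ (k - 1) * c + R := by
  have hq : 0 ≤ q := hr.trans hrq
  induction k with
  | zero => simpa using hR
  | succ k ih =>
    have hpow : k * q ^ (k - 1) * q = k * q ^ k := by
      cases k with
      | zero => simp
      | succ k => rw [Nat.add_sub_cancel, pow_succ]; ring
    calc a (k + 1) ≤ r * (q ^ k * a 0 + k * q ^ (k - 1) * c + R) + q ^ k * c + (1 - r) * R := by
          have := mul_le_mul_of_nonneg_left ih hr
          linarith [h k]
      _ = r * (q ^ k * a 0 + k * q ^ (k - 1) * c) + q ^ k * c + R := by ring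
      _ ≤ q * (q ^ k * a 0 + k * q ^ (k - 1) * c) + q ^ k * c + R := by gcongr
      _ = q ^ (k + 1) * a 0 + (k * q ^ (k - 1) * q + q ^ k) * c + R := by ring
      _ = _ := by rw [hpow, Nat.add_sub_cancel]; push_cast; ring

noncomputable section AffineRecursion

variable {Ω S : Type*} [MeasurableSpace Ω] [MeasurableSpace S] {n : Type*} [Fintype n]
  [DecidableEq n]

/-- A random affine recursion `U (k + 1) = A (δ k) U k + B (δ k) V` whose driving variables `δ k`
have law `ρ`, each independent of the current state and of the forcing vector `V`. The coefficients
are essentially bounded, so that square integrability propagates, and `B (δ k)` is centred. -/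
structure IsAffineRecursion (A B : S → Matrix n n ℝ) (ρ : Measure S) (δ : ℕ → Ω → S)
    (U : ℕ → Ω → n → ℝ) (V : Ω → n → ℝ) (μ : Measure Ω) : Prop where
  memLp_coeff : MemLp A ⊤ ρ
  memLp_forcing : MemLp B ⊤ ρ
  integral_forcing : ∫ s, B s ∂ρ = 0
  hasLaw (k : ℕ) : HasLaw (δ k) ρ μ
  indepFun (k : ℕ) : IndepFun (δ k) (fun ω => (U k ω, V ω)) μ
  memLp_zero : MemLp (U 0) 2 μ
  memLp_right : MemLp V 2 μ
  step (k : ℕ) : U (k + 1) =ᵐ[μ] fun ω => A (δ k ω) *ᵥ U k ω + B (δ k ω) *ᵥ V ω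

namespace IsAffineRecursion

variable {A B : S → Matrix n n ℝ} {ρ : Measure S} {δ : ℕ → Ω → S} {U : ℕ → Ω → n → ℝ}
  {V : Ω → n → ℝ} {μ : Measure Ω}

lemma memLp (h : IsAffineRecursion A B ρ δ U V μ) (k : ℕ) : MemLp (U k) 2 μ := by
  induction k with
  | zero => exact h.memLp_zero
  | succ k ih =>
    exact (memLp_congr_ae (h.step k)).2 ((memLp_random_mulVec (h.hasLaw k) h.memLp_coeff ih).add
      (memLp_random_mulVec (h.hasLaw k) h.memLp_forcing h.memLp_right))

variable [IsProbabilityMeasure ρ]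

lemma crossCov_eq [IsProbabilityMeasure μ] (h : IsAffineRecursion A B ρ δ U V μ) (k : ℕ) :
    crossCov (U k) V μ = (∫ s, A s ∂ρ) ^ k * crossCov (U 0) V μ := by
  induction k with
  | zero => simp only [pow_zero, one_mul]
  | succ k ih =>
    have hVV : IndepFun (δ k) (fun ω => (V ω, V ω)) μ := by
      have hφ : Measurable fun x : (n → ℝ) × (n → ℝ) => (x.2, x.2) := by fun_prop
      exact (h.indepFun k).comp measurable_id hφ
    rw [crossCov_congr_left (h.step k),
      crossCov_add_left (memLp_random_mulVec (h.hasLaw k) h.memLp_coeff (h.memLp k))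
        (memLp_random_mulVec (h.hasLaw k) h.memLp_forcing h.memLp_right) h.memLp_right,
      crossCov_random_mulVec_left (h.hasLaw k) h.memLp_coeff (h.memLp k) h.memLp_right
        (h.indepFun k),
      crossCov_random_mulVec_left (h.hasLaw k) h.memLp_forcing h.memLp_right h.memLp_right hVV,
      h.integral_forcing, zero_mul, add_zero, ih, ← mul_assoc, ← pow_succ']

lemma integral_dotProduct_mulVec (h : IsAffineRecursion A B ρ δ U V μ) (M : Matrix n n ℝ)
    (k : ℕ) :
    ∫ ω, V ω ⬝ᵥ (M *ᵥ U k ω) ∂μ = ∫ ω, V ω ⬝ᵥ ((M * (∫ s, A s ∂ρ) ^ k) *ᵥ U 0 ω) ∂μ := by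
  induction k generalizing M with
  | zero => simp only [pow_zero, mul_one]
  | succ k ih =>
    have hMV : MemLp (fun ω => Mᵀ *ᵥ V ω) 2 μ := memLp_mulVec _ h.memLp_right
    have hAU := memLp_random_mulVec (h.hasLaw k) h.memLp_coeff (h.memLp k)
    have hBV := memLp_random_mulVec (h.hasLaw k) h.memLp_forcing h.memLp_right
    have hφ : Measurable fun x : (n → ℝ) × (n → ℝ) => (Mᵀ *ᵥ x.2, x.1) := by fun_prop
    have hψ : Measurable fun x : (n → ℝ) × (n → ℝ) => (Mᵀ *ᵥ x.2, x.2) := by fun_prop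
    calc ∫ ω, V ω ⬝ᵥ (M *ᵥ U (k + 1) ω) ∂μ
        = ∫ ω, (Mᵀ *ᵥ V ω) ⬝ᵥ (A (δ k ω) *ᵥ U k ω)
            + (Mᵀ *ᵥ V ω) ⬝ᵥ (B (δ k ω) *ᵥ V ω) ∂μ := by
          refine integral_congr_ae ((h.step k).mono fun ω hω => ?_)
          simp only [hω, Matrix.mulVec_transpose, ← Matrix.dotProduct_mulVec, ← dotProduct_add,
            Matrix.mulVec_add]
      _ = ∫ ω, (Mᵀ *ᵥ V ω) ⬝ᵥ ((∫ s, A s ∂ρ) *ᵥ U k ω) ∂μ := by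
          rw [integral_add (integrable_dotProduct hMV hAU) (integrable_dotProduct hMV hBV),
            integral_dotProduct_random_mulVec (h.hasLaw k) h.memLp_coeff hMV (h.memLp k)
              ((h.indepFun k).comp measurable_id hφ),
            integral_dotProduct_random_mulVec (h.hasLaw k) h.memLp_forcing hMV h.memLp_right
              ((h.indepFun k).comp measurable_id hψ), h.integral_forcing]
          simp only [Matrix.zero_mulVec, dotProduct_zero, integral_zero, add_zero]
      _ = ∫ ω, V ω ⬝ᵥ ((M * ∫ s, A s ∂ρ) *ᵥ U k ω) ∂μ := by
          simp only [Matrix.mulVec_transpose, ← Matrix.dotProduct_mulVec, Matrix.mulVec_mulVec]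
      _ = _ := by rw [ih, mul_assoc, ← pow_succ']

lemma integral_dotProduct_self_succ (h : IsAffineRecursion A B ρ δ U V μ) (k : ℕ) :
    ∫ ω, U (k + 1) ω ⬝ᵥ U (k + 1) ω ∂μ
      = ∫ ω, U k ω ⬝ᵥ ((∫ s, (A s)ᵀ * A s ∂ρ) *ᵥ U k ω) ∂μ
        + 2 * ∫ ω, V ω ⬝ᵥ ((∫ s, (B s)ᵀ * A s ∂ρ) *ᵥ U k ω) ∂μ
        + ∫ ω, V ω ⬝ᵥ ((∫ s, (B s)ᵀ * B s ∂ρ) *ᵥ V ω) ∂μ := by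
  have hAU := memLp_random_mulVec (h.hasLaw k) h.memLp_coeff (h.memLp k)
  have hBV := memLp_random_mulVec (h.hasLaw k) h.memLp_forcing h.memLp_right
  have hUU : Measurable fun x : (n → ℝ) × (n → ℝ) => (x.1, x.1) := by fun_prop
  have hVV : Measurable fun x : (n → ℝ) × (n → ℝ) => (x.2, x.2) := by fun_prop
  calc ∫ ω, U (k + 1) ω ⬝ᵥ U (k + 1) ω ∂μ
      = ∫ ω, (B (δ k ω) *ᵥ V ω + A (δ k ω) *ᵥ U k ω)
          ⬝ᵥ (B (δ k ω) *ᵥ V ω + A (δ k ω) *ᵥ U k ω) ∂μ :=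
        integral_congr_ae ((h.step k).mono fun ω hω => by simp only [hω, add_comm])
    _ = _ := by
        rw [integral_add_dotProduct_add_self hBV hAU,
          integral_random_mulVec_dotProduct_random_mulVec (h.hasLaw k) h.memLp_forcing
            h.memLp_forcing h.memLp_right h.memLp_right ((h.indepFun k).comp measurable_id hVV),
          integral_random_mulVec_dotProduct_random_mulVec (h.hasLaw k) h.memLp_forcing
            h.memLp_coeff h.memLp_right (h.memLp k)
            ((h.indepFun k).comp measurable_id measurable_swap),
          integral_random_mulVec_dotProduct_random_mulVec (h.hasLaw k) h.memLp_coeff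
            h.memLp_coeff (h.memLp k) (h.memLp k) ((h.indepFun k).comp measurable_id hUU)]
        ring

lemma integral_dotProduct_self_succ_le (h : IsAffineRecursion A B ρ δ U V μ) {r s c T : ℝ}
    (hA : ∀ u, u ⬝ᵥ ((∫ s, (A s)ᵀ * A s ∂ρ) *ᵥ u) ≤ r * (u ⬝ᵥ u))
    (hB : ∀ v, v ⬝ᵥ ((∫ s, (B s)ᵀ * B s ∂ρ) *ᵥ v) ≤ s * (v ⬝ᵥ v)) (hs : 0 ≤ s)
    (hBA : ‖∫ s, (B s)ᵀ * A s ∂ρ‖ ≤ c)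
    (hU : ∫ ω, U 0 ω ⬝ᵥ U 0 ω ∂μ ≤ T) (hV : ∫ ω, V ω ⬝ᵥ V ω ∂μ ≤ T) (k : ℕ) :
    ∫ ω, U (k + 1) ω ⬝ᵥ U (k + 1) ω ∂μ
      ≤ r * ∫ ω, U k ω ⬝ᵥ U k ω ∂μ + ‖∫ s, A s ∂ρ‖ ^ k * (2 * c * T) + s * T := by
  have hUk := h.memLp k
  set N := (∫ s, (B s)ᵀ * A s ∂ρ) * (∫ s, A s ∂ρ) ^ k
  have hNorm : ‖N‖ ≤ c * ‖∫ s, A s ∂ρ‖ ^ k :=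
    (norm_mul_le _ _).trans (mul_le_mul hBA (norm_matrix_pow_le _ k) (norm_nonneg _)
      ((norm_nonneg _).trans hBA))
  have hquad : ∫ ω, U k ω ⬝ᵥ ((∫ s, (A s)ᵀ * A s ∂ρ) *ᵥ U k ω) ∂μ
      ≤ r * ∫ ω, U k ω ⬝ᵥ U k ω ∂μ := by
    rw [← integral_const_mul]
    exact integral_mono (integrable_dotProduct hUk (memLp_mulVec _ hUk))
      ((integrable_dotProduct hUk hUk).const_mul r) fun ω => hA (U k ω)
  have hforce : ∫ ω, V ω ⬝ᵥ ((∫ s, (B s)ᵀ * B s ∂ρ) *ᵥ V ω) ∂μ ≤ s * T := by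
    refine le_trans ?_ (mul_le_mul_of_nonneg_left hV hs)
    rw [← integral_const_mul]
    exact integral_mono (integrable_dotProduct h.memLp_right (memLp_mulVec _ h.memLp_right))
      ((integrable_dotProduct h.memLp_right h.memLp_right).const_mul s) fun ω => hB (V ω)
  have hcross : 2 * ∫ ω, V ω ⬝ᵥ (N *ᵥ U 0 ω) ∂μ ≤ ‖∫ s, A s ∂ρ‖ ^ k * (2 * c * T) := by
    refine (two_mul_integral_dotProduct_mulVec_le N h.memLp_right h.memLp_zero).trans ?_
    have hVU := add_nonneg (integral_dotProduct_self_nonneg (μ := μ) V)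
      (integral_dotProduct_self_nonneg (μ := μ) (U 0))
    calc _ ≤ (c * ‖∫ s, A s ∂ρ‖ ^ k) * (T + T) :=
          mul_le_mul hNorm (add_le_add hV hU) hVU ((norm_nonneg _).trans hNorm)
      _ = _ := by ring
  rw [h.integral_dotProduct_self_succ k, h.integral_dotProduct_mulVec]
  linarith

lemma integral_dotProduct_self_le (h : IsAffineRecursion A B ρ δ U V μ) {r s c T R : ℝ}
    (hA : ∀ u, u ⬝ᵥ ((∫ s, (A s)ᵀ * A s ∂ρ) *ᵥ u) ≤ r * (u ⬝ᵥ u))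
    (hB : ∀ v, v ⬝ᵥ ((∫ s, (B s)ᵀ * B s ∂ρ) *ᵥ v) ≤ s * (v ⬝ᵥ v)) (hs : 0 ≤ s)
    (hBA : ‖∫ s, (B s)ᵀ * A s ∂ρ‖ ≤ c)
    (hU : ∫ ω, U 0 ω ⬝ᵥ U 0 ω ∂μ ≤ T) (hV : ∫ ω, V ω ⬝ᵥ V ω ∂μ ≤ T)
    (hr : 0 ≤ r) (hrP : r ≤ ‖∫ s, A s ∂ρ‖) (hsR : s * T ≤ (1 - r) * R) (hR : 0 ≤ R) (k : ℕ) :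
    ∫ ω, U k ω ⬝ᵥ U k ω ∂μ
      ≤ ‖∫ s, A s ∂ρ‖ ^ k * T + k * ‖∫ s, A s ∂ρ‖ ^ (k - 1) * (2 * c * T) + R := by
  have hT : 0 ≤ T := (integral_dotProduct_self_nonneg V).trans hV
  have hc : 0 ≤ 2 * c * T := mul_nonneg (mul_nonneg two_pos.le ((norm_nonneg _).trans hBA)) hT
  have hrec := le_of_affine_recursion (a := fun k => ∫ ω, U k ω ⬝ᵥ U k ω ∂μ) hr hrP hc
    (integral_dotProduct_self_nonneg _) hR
    (fun k => (h.integral_dotProduct_self_succ_le hA hB hs hBA hU hV k).trans (by gcongr)) k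
  exact hrec.trans (by gcongr)

lemma norm_crossCov_add_self_sub_le [IsProbabilityMeasure μ]
    (h : IsAffineRecursion A B ρ δ U V μ) {r s c T R : ℝ}
    (hA : ∀ u, u ⬝ᵥ ((∫ s, (A s)ᵀ * A s ∂ρ) *ᵥ u) ≤ r * (u ⬝ᵥ u))
    (hB : ∀ v, v ⬝ᵥ ((∫ s, (B s)ᵀ * B s ∂ρ) *ᵥ v) ≤ s * (v ⬝ᵥ v)) (hs : 0 ≤ s)
    (hBA : ‖∫ s, (B s)ᵀ * A s ∂ρ‖ ≤ c)
    (hU : ∫ ω, U 0 ω ⬝ᵥ U 0 ω ∂μ ≤ T) (hV : ∫ ω, V ω ⬝ᵥ V ω ∂μ ≤ T)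
    (hr : 0 ≤ r) (hrP : r ≤ ‖∫ s, A s ∂ρ‖) (hsR : s * T ≤ (1 - r) * R) (hR : 0 ≤ R) {k : ℕ}
    (hk : 1 ≤ k) :
    ‖crossCov (fun ω => U k ω + V ω) (fun ω => U k ω + V ω) μ - crossCov V V μ‖
      ≤ k * ‖∫ s, A s ∂ρ‖ ^ (k - 1) * ((3 * ‖∫ s, A s ∂ρ‖ + 2 * c) * T) + R := by
  have hT : 0 ≤ T := (integral_dotProduct_self_nonneg V).trans hV
  have hcross : ‖crossCov (U k) V μ‖ ≤ ‖∫ s, A s ∂ρ‖ ^ k * T := by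
    rw [h.crossCov_eq k]
    exact (norm_mul_le _ _).trans (mul_le_mul (norm_matrix_pow_le _ k)
      (norm_crossCov_le h.memLp_zero h.memLp_right hU hV) (norm_nonneg _) (by positivity))
  have hpow : ‖∫ s, A s ∂ρ‖ ^ k ≤ k * ‖∫ s, A s ∂ρ‖ ^ (k - 1) * ‖∫ s, A s ∂ρ‖ := by
    rw [mul_assoc, pow_sub_one_mul (by omega)]
    exact le_mul_of_one_le_left (by positivity) (by exact_mod_cast hk)
  refine (Dropout.norm_crossCov_add_self_sub_le (h.memLp k) h.memLp_right).trans ?_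
  have hsq := h.integral_dotProduct_self_le hA hB hs hBA hU hV hr hrP hsR hR k
  have hpowT := mul_le_mul_of_nonneg_right hpow hT
  linarith

end IsAffineRecursion

end AffineRecursion

section Law

variable {d : ℕ} {p : unitInterval}

instance isProbabilityMeasure_dropoutLaw : IsProbabilityMeasure (dropoutLaw d p) := by
  unfold dropoutLaw; infer_instance

lemma ae_eq_one_or_eq_zero : ∀ᵐ δ ∂(dropoutLaw d p), ∀ i, δ i = 1 ∨ δ i = 0 := by
  refine ae_all_iff.2 fun i => ?_
  have hs : MeasurableSet ({1, 0} : Set ℝ)ᶜ := (Set.toFinite _).measurableSet.compl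
  have hBer : ∀ᵐ x ∂(bernoulliMeasure (1 : ℝ) 0 p), x ∈ ({1, 0} : Set ℝ) :=
    bernoulliMeasure_apply_of_notMem_of_notMem p hs (by simp) (by simp)
  exact (measurePreserving_eval (fun _ : Fin d => bernoulliMeasure (1 : ℝ) 0 p)
    i).quasiMeasurePreserving.ae hBer

lemma ae_diagonal_mul_self : ∀ᵐ δ ∂(dropoutLaw d p),
    (Matrix.diagonal δ * Matrix.diagonal δ : Matrix (Fin d) (Fin d) ℝ) = Matrix.diagonal δ := by
  filter_upwards [ae_eq_one_or_eq_zero] with δ hδ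
  rw [Matrix.diagonal_mul_diagonal]
  congr 1
  ext i
  rcases hδ i with h | h <;> simp [h]

lemma memLp_top_dropoutLaw {E : Type*} [NormedAddCommGroup E] {f : (Fin d → ℝ) → E}
    (hf : Continuous f) : MemLp f ⊤ (dropoutLaw d p) := by
  obtain ⟨C, hC⟩ := (isCompact_Icc (a := (0 : Fin d → ℝ)) (b := 1)).exists_bound_of_continuousOn
    hf.continuousOn
  refine memLp_top_of_bound hf.aestronglyMeasurable C ?_
  filter_upwards [ae_eq_one_or_eq_zero] with δ hδ
  refine hC δ ⟨fun i => ?_, fun i => ?_⟩ <;> rcases hδ i with h | h <;> simp [h]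

lemma integrable_dropoutLaw {E : Type*} [NormedAddCommGroup E] {f : (Fin d → ℝ) → E}
    (hf : Continuous f) : Integrable f (dropoutLaw d p) :=
  (memLp_top_dropoutLaw hf).integrable le_top

lemma integral_prod_dropoutLaw (s : Finset (Fin d)) :
    ∫ δ, ∏ i ∈ s, δ i ∂(dropoutLaw d p) = (p : ℝ) ^ s.card := by
  have h (i : Fin d) : ∫ x, (if i ∈ s then x else 1) ∂(bernoulliMeasure (1 : ℝ) 0 p)
      = if i ∈ s then (p : ℝ) else 1 := by
    split_ifs <;> simp [integral_bernoulliMeasure]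
  calc ∫ δ, ∏ i ∈ s, δ i ∂(dropoutLaw d p)
      = ∫ δ, ∏ i, (if i ∈ s then δ i else 1) ∂(dropoutLaw d p) := by
        simp only [Finset.prod_ite_mem, Finset.univ_inter]
    _ = ∏ i, ∫ x, (if i ∈ s then x else 1) ∂(bernoulliMeasure (1 : ℝ) 0 p) :=
        integral_fintype_prod_eq_prod fun i x => if i ∈ s then x else 1
    _ = (p : ℝ) ^ s.card := by
        simp only [h, Finset.prod_ite_mem, Finset.univ_inter, Finset.prod_const]

lemma integral_apply_dropoutLaw (i : Fin d) : ∫ δ, δ i ∂(dropoutLaw d p) = p := by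
  simpa using integral_prod_dropoutLaw (p := p) {i}

lemma integral_mul_dropoutLaw {i j : Fin d} (hij : i ≠ j) :
    ∫ δ, δ i * δ j ∂(dropoutLaw d p) = (p : ℝ) ^ 2 := by
  simpa [Finset.prod_pair hij, Finset.card_pair hij] using
    integral_prod_dropoutLaw (p := p) {i, j}

lemma integral_mul_self_dropoutLaw (i : Fin d) : ∫ δ, δ i * δ i ∂(dropoutLaw d p) = p := by
  rw [← integral_apply_dropoutLaw i]
  refine integral_congr_ae ?_
  filter_upwards [ae_eq_one_or_eq_zero] with δ hδ
  rcases hδ i with h | h <;> simp [h]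

lemma offDiagScale_apply (p : ℝ) (A : Matrix (Fin d) (Fin d) ℝ) (i j : Fin d) :
    offDiagScale p A i j = if i = j then A i j else p * A i j := by
  simp only [offDiagScale, diagPart, Matrix.add_apply, Matrix.smul_apply, smul_eq_mul,
    Matrix.diagonal_apply, Matrix.diag_apply]
  split_ifs with h
  · subst h; ring
  · ring

lemma integral_diagonal_dropoutLaw :
    ∫ δ, (Matrix.diagonal δ : Matrix (Fin d) (Fin d) ℝ) ∂(dropoutLaw d p) = (p : ℝ) • 1 := by
  ext i j
  rw [integral_matrix_apply (integrable_dropoutLaw (by fun_prop)), Matrix.smul_one_eq_diagonal]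
  simp only [Matrix.diagonal_apply]
  split_ifs with h
  · exact integral_apply_dropoutLaw i
  · exact integral_zero _ _

lemma integral_diagonal_mul_mul_diagonal (A : Matrix (Fin d) (Fin d) ℝ) :
    ∫ δ, Matrix.diagonal δ * A * Matrix.diagonal δ ∂(dropoutLaw d p)
      = (p : ℝ) • offDiagScale p A := by
  ext i j
  rw [integral_matrix_apply (integrable_dropoutLaw (by fun_prop)), Matrix.smul_apply,
    offDiagScale_apply]
  simp only [Matrix.mul_diagonal, Matrix.diagonal_mul, mul_right_comm _ (A i j), smul_eq_mul]
  rw [integral_mul_const]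
  split_ifs with h
  · rw [h, integral_mul_self_dropoutLaw]
  · rw [integral_mul_dropoutLaw h]; ring

lemma integral_diagonal_mul_mul_sub_diagonal {A : Matrix (Fin d) (Fin d) ℝ} (hA : A.diag = 0) :
    ∫ δ, Matrix.diagonal δ * A * ((p : ℝ) • 1 - Matrix.diagonal δ) ∂(dropoutLaw d p) = 0 := by
  ext i j
  rw [integral_matrix_apply (integrable_dropoutLaw (by fun_prop)), Matrix.zero_apply]
  have h (δ : Fin d → ℝ) : (Matrix.diagonal δ * A * ((p : ℝ) • 1 - Matrix.diagonal δ)) i j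
      = A i j * (p * δ i - δ i * δ j) := by
    simp only [mul_sub, Matrix.mul_smul, mul_one, Matrix.sub_apply, Matrix.smul_apply,
      Matrix.mul_diagonal, Matrix.diagonal_mul, smul_eq_mul]
    ring
  simp only [h]
  rw [integral_const_mul]
  rcases eq_or_ne i j with rfl | hij
  · rw [show A i i = 0 from congrFun hA i, zero_mul]
  · rw [integral_sub (integrable_dropoutLaw (by fun_prop)) (integrable_dropoutLaw (by fun_prop)),
      integral_const_mul, integral_apply_dropoutLaw, integral_mul_dropoutLaw hij]
    ring

lemma integral_sub_mul_mul_sub_dropoutLaw {i j l : Fin d} (hil : i ≠ l) (hjl : j ≠ l) :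
    ∫ δ, (p - δ i) * δ l * (p - δ j) ∂(dropoutLaw d p)
      = if i = j then (p : ℝ) ^ 2 * (1 - p) else 0 := by
  have hexpand (δ : Fin d → ℝ) : (p - δ i) * δ l * (p - δ j)
      = p ^ 2 * δ l - p * (δ i * δ l) - p * (δ j * δ l) + δ i * δ j * δ l := by ring
  simp only [hexpand]
  rw [integral_add (integrable_dropoutLaw (by fun_prop)) (integrable_dropoutLaw (by fun_prop)),
    integral_sub (integrable_dropoutLaw (by fun_prop)) (integrable_dropoutLaw (by fun_prop)),
    integral_sub (integrable_dropoutLaw (by fun_prop)) (integrable_dropoutLaw (by fun_prop))]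
  simp only [integral_const_mul, integral_apply_dropoutLaw, integral_mul_dropoutLaw hil,
    integral_mul_dropoutLaw hjl]
  split_ifs with hij
  · subst hij
    have hsq : ∫ δ, δ i * δ i * δ l ∂(dropoutLaw d p) = (p : ℝ) ^ 2 := by
      rw [← integral_mul_dropoutLaw hil]
      refine integral_congr_ae ?_
      filter_upwards [ae_eq_one_or_eq_zero] with δ hδ
      rcases hδ i with h | h <;> simp [h]
    rw [hsq]; ring
  · have hcube : ∫ δ, δ i * δ j * δ l ∂(dropoutLaw d p) = (p : ℝ) ^ 3 := by
      rw [← Finset.card_eq_three.2 ⟨i, j, l, hij, hil, hjl, rfl⟩,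
        ← integral_prod_dropoutLaw (p := p) {i, j, l}]
      simp [Finset.prod_insert, hij, hil, hjl, mul_assoc]
    rw [hcube]; ring

lemma integral_sub_diagonal_mul_transpose_mul_diagonal_mul_sub_diagonal
    {A : Matrix (Fin d) (Fin d) ℝ} (hA : A.diag = 0) :
    ∫ δ, ((p : ℝ) • 1 - Matrix.diagonal δ) * (Aᵀ * Matrix.diagonal δ * A)
        * ((p : ℝ) • 1 - Matrix.diagonal δ) ∂(dropoutLaw d p)
      = ((p : ℝ) ^ 2 * (1 - p)) • diagPart (Aᵀ * A) := by
  have hdiag (i : Fin d) : A i i = 0 := congrFun hA i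
  ext i j
  rw [integral_matrix_apply (integrable_dropoutLaw (by fun_prop))]
  have h (δ : Fin d → ℝ) : (((p : ℝ) • 1 - Matrix.diagonal δ) * (Aᵀ * Matrix.diagonal δ * A)
        * ((p : ℝ) • 1 - Matrix.diagonal δ)) i j
      = ∑ l, A l i * A l j * ((p - δ i) * δ l * (p - δ j)) := by
    rw [Matrix.smul_one_eq_diagonal, Matrix.diagonal_sub, Matrix.mul_diagonal,
      Matrix.diagonal_mul, Matrix.mul_apply, Finset.mul_sum, Finset.sum_mul]
    simp only [Matrix.mul_diagonal, Matrix.transpose_apply]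
    exact Finset.sum_congr rfl fun l _ => by ring
  have hl (l : Fin d) : A l i * A l j * ∫ δ, (p - δ i) * δ l * (p - δ j) ∂(dropoutLaw d p)
      = A l i * A l j * if i = j then (p : ℝ) ^ 2 * (1 - p) else 0 := by
    rcases eq_or_ne i l with rfl | hil
    · rw [hdiag]; ring
    rcases eq_or_ne j l with rfl | hjl
    · rw [hdiag]; ring
    rw [integral_sub_mul_mul_sub_dropoutLaw hil hjl]
  simp only [h]
  rw [integral_finsetSum _ fun l _ => integrable_dropoutLaw (by fun_prop)]
  simp only [integral_const_mul, hl, diagPart, Matrix.smul_apply, Matrix.diagonal_apply,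
    Matrix.diag_apply, Matrix.mul_apply, Matrix.transpose_apply, smul_eq_mul]
  split_ifs with hij
  · subst hij
    rw [← Finset.sum_mul, mul_comm]
  · simp only [mul_zero, Finset.sum_const_zero]

lemma ae_norm_diagonal_le_one :
    ∀ᵐ δ ∂(dropoutLaw d p), ‖(Matrix.diagonal δ : Matrix (Fin d) (Fin d) ℝ)‖ ≤ 1 := by
  filter_upwards [ae_eq_one_or_eq_zero] with δ hδ
  rw [Matrix.l2_opNorm_diagonal, pi_norm_le_iff_of_nonneg zero_le_one]
  exact fun i => by rcases hδ i with h | h <;> simp [h]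

lemma ae_norm_sub_diagonal_le_one :
    ∀ᵐ δ ∂(dropoutLaw d p), ‖(p : ℝ) • 1 - (Matrix.diagonal δ : Matrix (Fin d) (Fin d) ℝ)‖ ≤ 1 := by
  filter_upwards [ae_eq_one_or_eq_zero] with δ hδ
  rw [Matrix.smul_one_eq_diagonal, Matrix.diagonal_sub, Matrix.l2_opNorm_diagonal,
    pi_norm_le_iff_of_nonneg zero_le_one]
  intro i
  have hp₀ := p.2.1
  have hp₁ := p.2.2
  rw [Real.norm_eq_abs, abs_le]
  rcases hδ i with h | h <;> simp only [h] <;> constructor <;> linarith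

end Law

noncomputable section Coefficients

variable {d : ℕ} {p : unitInterval} {A G : Matrix (Fin d) (Fin d) ℝ}

/-- `A - Diag(A)`: the off-diagonal part of `A`. -/
def offDiag (A : Matrix (Fin d) (Fin d) ℝ) : Matrix (Fin d) (Fin d) ℝ :=
  A - diagPart A

lemma diag_offDiag (A : Matrix (Fin d) (Fin d) ℝ) : (offDiag A).diag = 0 := by
  ext i
  simp [offDiag, diagPart]

lemma offDiagScale_eq_diagPart_add (p : ℝ) (A : Matrix (Fin d) (Fin d) ℝ) :
    offDiagScale p A = diagPart A + p • offDiag A := by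
  rw [offDiagScale, offDiag, smul_sub, sub_smul, one_smul]
  abel

lemma norm_diagPart_le (A : Matrix (Fin d) (Fin d) ℝ) : ‖diagPart A‖ ≤ ‖A‖ := by
  rw [diagPart, Matrix.l2_opNorm_diagonal, pi_norm_le_iff_of_nonneg (norm_nonneg A)]
  exact fun i => abs_apply_le_norm A i i

lemma norm_offDiag_le (A : Matrix (Fin d) (Fin d) ℝ) : ‖offDiag A‖ ≤ 2 * ‖A‖ := by
  have h := norm_sub_le A (diagPart A)
  rw [offDiag]
  linarith [norm_diagPart_le A]

lemma norm_offDiagScale_le (p : unitInterval) (A : Matrix (Fin d) (Fin d) ℝ) :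
    ‖offDiagScale p A‖ ≤ ‖A‖ := by
  have hp := p.2.1
  have hp' := sub_nonneg.2 p.2.2
  calc ‖offDiagScale p A‖ ≤ p * ‖A‖ + (1 - p) * ‖diagPart A‖ := by
        refine (norm_add_le _ _).trans_eq ?_
        rw [norm_smul, norm_smul, Real.norm_of_nonneg hp, Real.norm_of_nonneg hp']
    _ ≤ p * ‖A‖ + (1 - p) * ‖A‖ := by gcongr; exact norm_diagPart_le A
    _ = ‖A‖ := by ring

/-- The random matrix `1 - α D G D`, where `D = Matrix.diagonal δ`, by which a step of gradient
descent with dropout multiplies the distance to the minimizer of the marginalized loss when the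
Gram matrix is `G`. -/
def errorCoeff (α : ℝ) (G : Matrix (Fin d) (Fin d) ℝ) (δ : Fin d → ℝ) :
    Matrix (Fin d) (Fin d) ℝ :=
  1 - α • (Matrix.diagonal δ * G * Matrix.diagonal δ)

/-- The random matrix `α D (G - Diag(G)) (p - D)`, where `D = Matrix.diagonal δ`, applied to the
minimizer of the marginalized loss to give the centred error made by a step of gradient descent with
dropout when the Gram matrix is `G`. -/
def errorForcing (α p : ℝ) (G : Matrix (Fin d) (Fin d) ℝ) (δ : Fin d → ℝ) :
    Matrix (Fin d) (Fin d) ℝ :=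
  α • (Matrix.diagonal δ * offDiag G * (p • 1 - Matrix.diagonal δ))

lemma continuous_errorCoeff (α : ℝ) (G : Matrix (Fin d) (Fin d) ℝ) :
    Continuous (errorCoeff α G) := by
  unfold errorCoeff
  fun_prop

lemma continuous_errorForcing (α p : ℝ) (G : Matrix (Fin d) (Fin d) ℝ) :
    Continuous (errorForcing α p G) := by
  unfold errorForcing
  fun_prop

lemma integral_errorCoeff (α : ℝ) (G : Matrix (Fin d) (Fin d) ℝ) :
    ∫ δ, errorCoeff α G δ ∂(dropoutLaw d p) = 1 - (α * p) • offDiagScale p G := by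
  unfold errorCoeff
  rw [integral_sub (integrable_dropoutLaw (by fun_prop)) (integrable_dropoutLaw (by fun_prop)),
    integral_const, probReal_univ, one_smul, integral_smul, integral_diagonal_mul_mul_diagonal,
    smul_smul]

lemma integral_errorForcing (α : ℝ) (G : Matrix (Fin d) (Fin d) ℝ) :
    ∫ δ, errorForcing α p G δ ∂(dropoutLaw d p) = 0 := by
  unfold errorForcing
  rw [integral_smul, integral_diagonal_mul_mul_sub_diagonal (diag_offDiag G), smul_zero]

lemma norm_integral_errorForcing_transpose_mul_errorCoeff_le (α : ℝ)
    (G : Matrix (Fin d) (Fin d) ℝ) :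
    ‖∫ δ, (errorForcing α p G δ)ᵀ * errorCoeff α G δ ∂(dropoutLaw d p)‖
      ≤ α ^ 2 * ‖G‖ * ‖offDiag G‖ := by
  have hcont := continuous_errorForcing α p G
  have hexpand (δ : Fin d → ℝ) : (errorForcing α p G δ)ᵀ * errorCoeff α G δ
      = (errorForcing α p G δ)ᵀ
        - (errorForcing α p G δ)ᵀ * (α • (Matrix.diagonal δ * G * Matrix.diagonal δ)) := by
    rw [errorCoeff, mul_sub, mul_one]
  simp only [hexpand]
  rw [integral_sub (integrable_dropoutLaw (by fun_prop)) (integrable_dropoutLaw (by fun_prop)),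
    integral_transpose (integrable_dropoutLaw hcont), integral_errorForcing,
    Matrix.transpose_zero, zero_sub, norm_neg]
  refine (norm_integral_le_of_norm_le_const (C := α ^ 2 * ‖G‖ * ‖offDiag G‖) ?_).trans_eq
    (by rw [probReal_univ, mul_one])
  filter_upwards [ae_norm_diagonal_le_one, ae_norm_sub_diagonal_le_one] with δ hD hpD
  have hforcing : ‖errorForcing α p G δ‖ ≤ |α| * ‖offDiag G‖ := by
    rw [errorForcing, norm_smul, Real.norm_eq_abs]
    gcongr
    calc _ ≤ ‖(Matrix.diagonal δ : Matrix (Fin d) (Fin d) ℝ)‖ * ‖offDiag G‖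
          * ‖(p : ℝ) • 1 - (Matrix.diagonal δ : Matrix (Fin d) (Fin d) ℝ)‖ := norm_mul₃_le
      _ ≤ 1 * ‖offDiag G‖ * 1 := by gcongr
      _ = ‖offDiag G‖ := by ring
  have hmasked : ‖Matrix.diagonal δ * G * Matrix.diagonal δ‖ ≤ ‖G‖ := by
    calc _ ≤ ‖(Matrix.diagonal δ : Matrix (Fin d) (Fin d) ℝ)‖ * ‖G‖
          * ‖(Matrix.diagonal δ : Matrix (Fin d) (Fin d) ℝ)‖ := norm_mul₃_le
      _ ≤ 1 * ‖G‖ * 1 := by gcongr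
      _ = ‖G‖ := by ring
  calc _ ≤ ‖errorForcing α p G δ‖ * (|α| * ‖Matrix.diagonal δ * G * Matrix.diagonal δ‖) := by
        refine (norm_mul_le _ _).trans_eq ?_
        rw [norm_transpose, norm_smul, Real.norm_eq_abs]
    _ ≤ (|α| * ‖offDiag G‖) * (|α| * ‖G‖) := by gcongr
    _ = α ^ 2 * ‖G‖ * ‖offDiag G‖ := by rw [← sq_abs α]; ring

lemma integral_diagonal_mulVec_dotProduct_self (u : Fin d → ℝ) :
    ∫ δ, (Matrix.diagonal δ *ᵥ u) ⬝ᵥ (Matrix.diagonal δ *ᵥ u) ∂(dropoutLaw d p)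
      = p * (u ⬝ᵥ u) := by
  have h (δ : Fin d → ℝ) : (Matrix.diagonal δ *ᵥ u) ⬝ᵥ (Matrix.diagonal δ *ᵥ u)
      = ∑ i, δ i * δ i * (u i * u i) := by
    simp only [dotProduct, Matrix.mulVec_diagonal]
    exact Finset.sum_congr rfl fun i _ => by ring
  simp only [h]
  rw [integral_finsetSum _ fun i _ => integrable_dropoutLaw (by fun_prop)]
  simp only [integral_mul_const, integral_mul_self_dropoutLaw, ← Finset.mul_sum, dotProduct]

lemma integral_masked_mulVec_dotProduct_self_le (G : Matrix (Fin d) (Fin d) ℝ) (u : Fin d → ℝ) :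
    ∫ δ, ((Matrix.diagonal δ * G * Matrix.diagonal δ) *ᵥ u)
        ⬝ᵥ ((Matrix.diagonal δ * G * Matrix.diagonal δ) *ᵥ u) ∂(dropoutLaw d p)
      ≤ ‖G‖ ^ 2 * (p * (u ⬝ᵥ u)) := by
  rw [← integral_diagonal_mulVec_dotProduct_self, ← integral_const_mul]
  refine integral_mono_ae (integrable_dropoutLaw (by fun_prop))
    (integrable_dropoutLaw (by fun_prop)) ?_
  filter_upwards [ae_norm_diagonal_le_one] with δ hδ
  rw [← Matrix.mulVec_mulVec]
  refine (mulVec_dotProduct_mulVec_self_le _ _).trans ?_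
  gcongr
  · exact dotProduct_self_nonneg _
  · calc ‖Matrix.diagonal δ * G‖ ≤ ‖(Matrix.diagonal δ : Matrix (Fin d) (Fin d) ℝ)‖ * ‖G‖ :=
          norm_mul_le _ _
      _ ≤ 1 * ‖G‖ := by gcongr
      _ = ‖G‖ := one_mul _

lemma dotProduct_integral_errorCoeff_mulVec_le {α c : ℝ} (hα : 0 ≤ α)
    (hG : ∀ u, c * (u ⬝ᵥ u) ≤ u ⬝ᵥ (offDiagScale p G *ᵥ u)) (u : Fin d → ℝ) :
    u ⬝ᵥ ((∫ δ, (errorCoeff α G δ)ᵀ * errorCoeff α G δ ∂(dropoutLaw d p)) *ᵥ u)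
      ≤ (1 - 2 * α * p * c + α ^ 2 * p * ‖G‖ ^ 2) * (u ⬝ᵥ u) := by
  have hcont := continuous_errorCoeff α G
  have hexpand (δ : Fin d → ℝ) : u ⬝ᵥ (((errorCoeff α G δ)ᵀ * errorCoeff α G δ) *ᵥ u)
      = u ⬝ᵥ u - 2 * α * (u ⬝ᵥ ((Matrix.diagonal δ * G * Matrix.diagonal δ) *ᵥ u))
        + α ^ 2 * (((Matrix.diagonal δ * G * Matrix.diagonal δ) *ᵥ u)
          ⬝ᵥ ((Matrix.diagonal δ * G * Matrix.diagonal δ) *ᵥ u)) := by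
    rw [dotProduct_transpose_mul_mulVec, errorCoeff, Matrix.sub_mulVec, Matrix.one_mulVec,
      Matrix.smul_mulVec]
    simp only [sub_dotProduct, dotProduct_sub, smul_dotProduct, dotProduct_smul, smul_eq_mul]
    rw [dotProduct_comm ((Matrix.diagonal δ * G * Matrix.diagonal δ) *ᵥ u) u]
    ring
  rw [dotProduct_integral_mulVec (integrable_dropoutLaw (by fun_prop))]
  simp only [hexpand]
  rw [integral_add (integrable_dropoutLaw (by fun_prop)) (integrable_dropoutLaw (by fun_prop)),
    integral_sub (integrable_dropoutLaw (by fun_prop)) (integrable_dropoutLaw (by fun_prop)),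
    integral_const_mul, integral_const_mul,
    ← dotProduct_integral_mulVec (integrable_dropoutLaw (by fun_prop)),
    integral_diagonal_mul_mul_diagonal, Matrix.smul_mulVec, dotProduct_smul, smul_eq_mul,
    integral_const, probReal_univ, one_smul]
  have hdrift := mul_le_mul_of_nonneg_left (hG u) (mul_nonneg hα p.2.1)
  have hquad := mul_le_mul_of_nonneg_left
    (integral_masked_mulVec_dotProduct_self_le (p := p) G u) (sq_nonneg α)
  linarith

lemma integral_errorForcing_transpose_mul_self (α : ℝ) (G : Matrix (Fin d) (Fin d) ℝ) :
    ∫ δ, (errorForcing α p G δ)ᵀ * errorForcing α p G δ ∂(dropoutLaw d p)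
      = (α ^ 2 * ((p : ℝ) ^ 2 * (1 - p))) • diagPart ((offDiag G)ᵀ * offDiag G) := by
  have h : ∀ᵐ δ ∂(dropoutLaw d p), (errorForcing α p G δ)ᵀ * errorForcing α p G δ
      = α ^ 2 • (((p : ℝ) • 1 - Matrix.diagonal δ)
        * ((offDiag G)ᵀ * Matrix.diagonal δ * offDiag G) * ((p : ℝ) • 1 - Matrix.diagonal δ)) := by
    filter_upwards [ae_diagonal_mul_self] with δ hδ
    have hδ' (M : Matrix (Fin d) (Fin d) ℝ) :
        Matrix.diagonal δ * (Matrix.diagonal δ * M) = Matrix.diagonal δ * M := by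
      rw [← mul_assoc, hδ]
    simp only [errorForcing, Matrix.transpose_smul, Matrix.transpose_mul, Matrix.transpose_sub,
      Matrix.transpose_one, Matrix.diagonal_transpose, smul_mul_smul_comm, ← sq α, mul_assoc, hδ']
  rw [integral_congr_ae h, integral_smul,
    integral_sub_diagonal_mul_transpose_mul_diagonal_mul_sub_diagonal (diag_offDiag G), smul_smul]

lemma dotProduct_integral_errorForcing_mulVec_le (α : ℝ) (G : Matrix (Fin d) (Fin d) ℝ)
    (v : Fin d → ℝ) :
    v ⬝ᵥ ((∫ δ, (errorForcing α p G δ)ᵀ * errorForcing α p G δ ∂(dropoutLaw d p)) *ᵥ v)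
      ≤ α ^ 2 * (p ^ 2 * (1 - p)) * ‖offDiag G‖ ^ 2 * (v ⬝ᵥ v) := by
  have hp := sub_nonneg.2 p.2.2
  have hnorm : ‖diagPart ((offDiag G)ᵀ * offDiag G)‖ ≤ ‖offDiag G‖ ^ 2 := by
    refine (norm_diagPart_le _).trans ((norm_mul_le _ _).trans_eq ?_)
    rw [norm_transpose, sq]
  rw [integral_errorForcing_transpose_mul_self, Matrix.smul_mulVec, dotProduct_smul, smul_eq_mul,
    mul_assoc (_ * _)]
  gcongr
  have hquad := two_mul_abs_dotProduct_mulVec_le (diagPart ((offDiag G)ᵀ * offDiag G)) v v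
  have habs := le_abs_self (v ⬝ᵥ (diagPart ((offDiag G)ᵀ * offDiag G) *ᵥ v))
  have hle := mul_le_mul_of_nonneg_right hnorm (dotProduct_self_nonneg v)
  linarith

end Coefficients

section Spectral

variable {d : ℕ} {A : Matrix (Fin d) (Fin d) ℝ}

lemma lambdaMin_mul_le_dotProduct_mulVec (hA : A.IsHermitian) (u : Fin d → ℝ) :
    lambdaMin A * (u ⬝ᵥ u) ≤ u ⬝ᵥ (A *ᵥ u) := by
  have hpos : (A - lambdaMin A • 1).PosSemidef := by
    refine Matrix.posSemidef_iff_isHermitian_and_spectrum_nonneg.2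
      ⟨hA.sub (by simp [Matrix.IsHermitian]), ?_⟩
    rw [← Algebra.algebraMap_eq_smul_one, ← spectrum.sub_singleton_eq]
    rintro _ ⟨x, hx, _, rfl, rfl⟩
    exact sub_nonneg.2 (csInf_le A.finite_real_spectrum.bddBelow hx)
  have h := hpos.dotProduct_mulVec_nonneg u
  simp only [star_trivial, Matrix.sub_mulVec, Matrix.smul_mulVec, Matrix.one_mulVec,
    dotProduct_sub, dotProduct_smul, smul_eq_mul] at h
  linarith

lemma abs_le_norm_of_mulVec_eq_smul {c : ℝ} {v : Fin d → ℝ} (hv : 0 < v ⬝ᵥ v)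
    (h : A *ᵥ v = c • v) : |c| ≤ ‖A‖ := by
  have hle := mulVec_dotProduct_mulVec_self_le A v
  rw [h, smul_dotProduct, dotProduct_smul, smul_eq_mul, smul_eq_mul, ← mul_assoc, ← sq] at hle
  exact abs_le_of_sq_le_sq (le_of_mul_le_mul_right hle hv) (norm_nonneg A)

variable [NeZero d]

lemma exists_mulVec_eq_lambdaMin_smul (hA : A.IsHermitian) :
    ∃ v : Fin d → ℝ, 0 < v ⬝ᵥ v ∧ A *ᵥ v = lambdaMin A • v := by
  have hne : (spectrum ℝ A).Nonempty := by
    rw [hA.spectrum_real_eq_range_eigenvalues]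
    exact Set.range_nonempty _
  have hmem : lambdaMin A ∈ spectrum ℝ A := hne.csInf_mem A.finite_real_spectrum
  rw [hA.spectrum_real_eq_range_eigenvalues] at hmem
  obtain ⟨i, hi⟩ := hmem
  refine ⟨hA.eigenvectorBasis i, ?_, hi ▸ hA.mulVec_eigenvectorBasis i⟩
  rw [dotProduct_self_eq_norm_sq]
  simp

lemma le_lambdaMin (hA : A.IsHermitian) {c : ℝ}
    (hc : ∀ u : Fin d → ℝ, c * (u ⬝ᵥ u) ≤ u ⬝ᵥ (A *ᵥ u)) : c ≤ lambdaMin A := by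
  obtain ⟨v, hv, h⟩ := exists_mulVec_eq_lambdaMin_smul hA
  have hcv := hc v
  rw [h, dotProduct_smul, smul_eq_mul] at hcv
  exact le_of_mul_le_mul_right hcv hv

lemma lambdaMin_le_norm (hA : A.IsHermitian) : lambdaMin A ≤ ‖A‖ := by
  obtain ⟨v, hv, h⟩ := exists_mulVec_eq_lambdaMin_smul hA
  exact (le_abs_self _).trans (abs_le_norm_of_mulVec_eq_smul hv h)

lemma one_sub_mul_lambdaMin_le_norm (hA : A.IsHermitian) (t : ℝ) :
    1 - t * lambdaMin A ≤ ‖1 - t • A‖ := by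
  obtain ⟨v, hv, h⟩ := exists_mulVec_eq_lambdaMin_smul hA
  refine (le_abs_self _).trans (abs_le_norm_of_mulVec_eq_smul hv ?_)
  rw [Matrix.sub_mulVec, Matrix.one_mulVec, Matrix.smul_mulVec, h, sub_smul, one_smul, mul_smul]

end Spectral

section Minimizer

variable {ι : Type*} [Fintype ι] {A : Matrix ι ι ℝ}

lemma mulVec_eq_of_forall_quadratic_le (hA : A.IsSymm) {w v : ι → ℝ}
    (h : ∀ u, v ⬝ᵥ (A *ᵥ v) - 2 * (w ⬝ᵥ v) ≤ u ⬝ᵥ (A *ᵥ u) - 2 * (w ⬝ᵥ u)) : A *ᵥ v = w := by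
  set g := A *ᵥ v - w with hg
  have hvg : v ⬝ᵥ (A *ᵥ g) = g ⬝ᵥ (A *ᵥ v) := by
    rw [Matrix.dotProduct_mulVec, ← Matrix.mulVec_transpose, hA.eq, dotProduct_comm]
  have hgg : g ⬝ᵥ g = g ⬝ᵥ (A *ᵥ v) - w ⬝ᵥ g := by
    nth_rewrite 2 [hg]
    rw [dotProduct_sub, dotProduct_comm g w]
  have hquad (t : ℝ) : 0 ≤ (g ⬝ᵥ (A *ᵥ g)) * (t * t) + 2 * (g ⬝ᵥ g) * t + 0 := by
    have ht := h (v + t • g)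
    simp only [Matrix.mulVec_add, Matrix.mulVec_smul, dotProduct_add, add_dotProduct,
      dotProduct_smul, smul_dotProduct, smul_eq_mul, hvg] at ht
    rw [hgg]
    linarith
  have hdiscrim := discrim_le_zero hquad
  rw [discrim, mul_zero, sub_zero] at hdiscrim
  have hzero : g ⬝ᵥ g = 0 := by
    nlinarith [sq_nonneg (g ⬝ᵥ g)]
  exact sub_eq_zero.1 (dotProduct_self_eq_zero.1 hzero)

lemma sq_mul_dotProduct_self_le {c : ℝ} (hc : 0 ≤ c) {v : ι → ℝ}
    (h : c * (v ⬝ᵥ v) ≤ v ⬝ᵥ (A *ᵥ v)) : c ^ 2 * (v ⬝ᵥ v) ≤ (A *ᵥ v) ⬝ᵥ (A *ᵥ v) := by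
  have hnonneg := dotProduct_self_nonneg (A *ᵥ v - c • v)
  simp only [sub_dotProduct, dotProduct_sub, smul_dotProduct, dotProduct_smul, smul_eq_mul,
    dotProduct_comm (A *ᵥ v) v] at hnonneg
  have hc' := mul_le_mul_of_nonneg_left h hc
  linarith

end Minimizer

section Gram

variable {n d : ℕ} (X : Matrix (Fin n) (Fin d) ℝ) {p : unitInterval}

lemma gram_isSymm : (gram X).IsSymm := by
  rw [Matrix.IsSymm, gram, Matrix.transpose_mul, Matrix.transpose_transpose]

lemma offDiagScale_isSymm {A : Matrix (Fin d) (Fin d) ℝ} (hA : A.IsSymm) (p : ℝ) :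
    (offDiagScale p A).IsSymm :=
  (hA.smul p).add ((Matrix.isSymm_diagonal _).smul (1 - p))

lemma exists_forall_le_gram_apply_self (hX : ∀ j, ∃ i, X i j ≠ 0) :
    ∃ m : ℝ, 0 < m ∧ ∀ i, m ≤ gram X i i := by
  have hpos (j : Fin d) : 0 < gram X j j := by
    obtain ⟨i, hi⟩ := hX j
    simp only [gram, Matrix.mul_apply, Matrix.transpose_apply]
    exact Finset.sum_pos' (fun _ _ => mul_self_nonneg _)
      ⟨i, Finset.mem_univ _, mul_self_pos.2 hi⟩
  rcases isEmpty_or_nonempty (Fin d) with h | h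
  · exact ⟨1, one_pos, fun i => h.elim i⟩
  · obtain ⟨j, hj⟩ := Finite.exists_min fun j => gram X j j
    exact ⟨_, hpos j, hj⟩

variable {X}

lemma mul_dotProduct_self_le_dotProduct_offDiagScale_gram_mulVec {m : ℝ}
    (hm : ∀ i, m ≤ gram X i i) (u : Fin d → ℝ) :
    (1 - p) * m * (u ⬝ᵥ u) ≤ u ⬝ᵥ (offDiagScale p (gram X) *ᵥ u) := by
  have hgram : 0 ≤ u ⬝ᵥ (gram X *ᵥ u) := by
    rw [gram, dotProduct_transpose_mul_mulVec]
    exact dotProduct_self_nonneg _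
  have hdiag : m * (u ⬝ᵥ u) ≤ u ⬝ᵥ (diagPart (gram X) *ᵥ u) := by
    simp only [diagPart, dotProduct, Matrix.mulVec_diagonal, Finset.mul_sum, Matrix.diag_apply]
    refine Finset.sum_le_sum fun i _ => ?_
    nlinarith [hm i, mul_self_nonneg (u i)]
  simp only [offDiagScale, Matrix.add_mulVec, Matrix.smul_mulVec, dotProduct_add, dotProduct_smul,
    smul_eq_mul]
  have hp := mul_nonneg p.2.1 hgram
  have hq := mul_le_mul_of_nonneg_left hdiag (sub_nonneg.2 p.2.2)
  linarith

variable (X)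

lemma marginalizedLoss_eq (p : unitInterval) (y : Fin n → ℝ) (b : Fin d → ℝ) :
    marginalizedLoss X p y b
      = y ⬝ᵥ y + p * (b ⬝ᵥ (offDiagScale p (gram X) *ᵥ b) - 2 * ((Xᵀ *ᵥ y) ⬝ᵥ b)) := by
  have hexpand (δ : Fin d → ℝ) : ‖WithLp.toLp 2 (y - (X * Matrix.diagonal δ) *ᵥ b)‖ ^ 2
      = y ⬝ᵥ y - 2 * ((Xᵀ *ᵥ y) ⬝ᵥ (Matrix.diagonal δ *ᵥ b))
        + b ⬝ᵥ ((Matrix.diagonal δ * gram X * Matrix.diagonal δ) *ᵥ b) := by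
    have hquad : b ⬝ᵥ ((Matrix.diagonal δ * gram X * Matrix.diagonal δ) *ᵥ b)
        = ((X * Matrix.diagonal δ) *ᵥ b) ⬝ᵥ ((X * Matrix.diagonal δ) *ᵥ b) := by
      rw [← dotProduct_transpose_mul_mulVec, Matrix.transpose_mul, Matrix.diagonal_transpose, gram]
      simp only [Matrix.mul_assoc]
    rw [hquad, ← dotProduct_self_eq_norm_sq, Matrix.mulVec_transpose, ← Matrix.dotProduct_mulVec,
      Matrix.mulVec_mulVec]
    simp only [sub_dotProduct, dotProduct_sub]
    rw [dotProduct_comm ((X * Matrix.diagonal δ) *ᵥ b) y]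
    ring
  simp only [marginalizedLoss, hexpand]
  rw [integral_add (integrable_dropoutLaw (by fun_prop)) (integrable_dropoutLaw (by fun_prop)),
    integral_sub (integrable_dropoutLaw (by fun_prop)) (integrable_dropoutLaw (by fun_prop)),
    integral_const_mul, ← dotProduct_integral_mulVec (integrable_dropoutLaw (by fun_prop)),
    ← dotProduct_integral_mulVec (integrable_dropoutLaw (by fun_prop)),
    integral_diagonal_dropoutLaw, integral_diagonal_mul_mul_diagonal, integral_const,
    probReal_univ, one_smul]
  simp only [Matrix.smul_mulVec, Matrix.one_mulVec, dotProduct_smul, smul_eq_mul]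
  ring

variable {X}

lemma offDiagScale_gram_mulVec_minimizer {b : (Fin n → ℝ) → (Fin d → ℝ)} (hp : 0 < p)
    (hb : IsMarginalizedLossMinimizer X p b) (y : Fin n → ℝ) :
    offDiagScale p (gram X) *ᵥ b y = Xᵀ *ᵥ y := by
  refine mulVec_eq_of_forall_quadratic_le (offDiagScale_isSymm (gram_isSymm X) p) fun u => ?_
  have hmin : marginalizedLoss X p y (b y) ≤ marginalizedLoss X p y u := hb y (Set.mem_univ u)
  rw [marginalizedLoss_eq, marginalizedLoss_eq] at hmin
  exact le_of_mul_le_mul_left (le_of_add_le_add_left hmin) (show (0 : ℝ) < p from hp)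

lemma diagonal_mul_offDiagScale {δ : Fin d → ℝ}
    (hδ : (Matrix.diagonal δ * Matrix.diagonal δ : Matrix (Fin d) (Fin d) ℝ) = Matrix.diagonal δ)
    (p : ℝ) (A : Matrix (Fin d) (Fin d) ℝ) :
    Matrix.diagonal δ * offDiagScale p A
      = Matrix.diagonal δ * A * Matrix.diagonal δ
        + Matrix.diagonal δ * offDiag A * (p • 1 - Matrix.diagonal δ) := by
  have hdiag : Matrix.diagonal δ * diagPart A * Matrix.diagonal δ
      = Matrix.diagonal δ * diagPart A := by
    rw [diagPart, mul_assoc, (Matrix.commute_diagonal _ _).eq, ← mul_assoc, hδ]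
  have hA : A = diagPart A + offDiag A := by rw [offDiag]; abel
  nth_rewrite 2 [hA]
  rw [offDiagScale_eq_diagPart_add]
  simp only [mul_add, add_mul, mul_sub, Matrix.mul_smul, mul_one, hdiag]
  abel

lemma dropout_step_sub {δ : Fin d → ℝ}
    (hδ : (Matrix.diagonal δ * Matrix.diagonal δ : Matrix (Fin d) (Fin d) ℝ) = Matrix.diagonal δ)
    (α p : ℝ) {y : Fin n → ℝ} {v : Fin d → ℝ} (hv : offDiagScale p (gram X) *ᵥ v = Xᵀ *ᵥ y)
    (b : Fin d → ℝ) :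
    b + α • ((Matrix.diagonal δ * Xᵀ) *ᵥ (y - (X * Matrix.diagonal δ) *ᵥ b)) - v
      = errorCoeff α (gram X) δ *ᵥ (b - v) + errorForcing α p (gram X) δ *ᵥ v := by
  have hgrad : (Matrix.diagonal δ * Xᵀ) *ᵥ (y - (X * Matrix.diagonal δ) *ᵥ b)
      = (Matrix.diagonal δ * offDiagScale p (gram X)) *ᵥ v
        - (Matrix.diagonal δ * gram X * Matrix.diagonal δ) *ᵥ b := by
    rw [Matrix.mulVec_sub, ← Matrix.mulVec_mulVec v, hv, Matrix.mulVec_mulVec,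
      Matrix.mulVec_mulVec, gram]
    simp only [Matrix.mul_assoc]
  rw [hgrad, diagonal_mul_offDiagScale hδ, errorCoeff, errorForcing]
  simp only [Matrix.add_mulVec, Matrix.sub_mulVec, Matrix.smul_mulVec, Matrix.mulVec_sub,
    Matrix.one_mulVec, smul_add, smul_sub]
  abel

end Gram

section History

variable {Ω E K : Type*} [MeasurableSpace Ω] [MeasurableSpace E] [MeasurableSpace K]
  {μ : Measure Ω} [IsProbabilityMeasure μ]

lemma indepFun_prodMk_right_of_prodMk_left {F : Type*} [MeasurableSpace F]
    {U : Ω → E} {V : Ω → F} {W : Ω → K} (hU : AEMeasurable U μ) (hV : AEMeasurable V μ)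
    (hW : AEMeasurable W μ) (hUV : IndepFun U V μ) (hUVW : IndepFun (fun ω => (U ω, V ω)) W μ) :
    IndepFun U (fun ω => (V ω, W ω)) μ := by
  have hVW : IndepFun V W μ := hUVW.comp measurable_snd measurable_id
  have := Measure.isProbabilityMeasure_map hU
  have := Measure.isProbabilityMeasure_map hV
  have := Measure.isProbabilityMeasure_map hW
  rw [indepFun_iff_map_prod_eq_prod_map_map hU (hV.prodMk hW),
    (indepFun_iff_map_prod_eq_prod_map_map hV hW).1 hVW, ← Measure.prodAssoc_prod,
    ← (indepFun_iff_map_prod_eq_prod_map_map hU hV).1 hUV,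
    ← (indepFun_iff_map_prod_eq_prod_map_map (hU.prodMk hV) hW).1 hUVW,
    AEMeasurable.map_map_of_aemeasurable (MeasurableEquiv.measurable _).aemeasurable
      ((hU.prodMk hV).prodMk hW)]
  rfl

lemma indepFun_history {δ : ℕ → Ω → E} {Z : Ω → K} (hδ : ∀ k, AEMeasurable (δ k) μ)
    (hZ : AEMeasurable Z μ) (hind : iIndepFun δ μ) (h : IndepFun (fun ω k => δ k ω) Z μ) (k : ℕ) :
    IndepFun (δ k) (fun ω => ((fun j : Finset.range k => δ j ω), Z ω)) μ := by
  refine indepFun_prodMk_right_of_prodMk_left (hδ k) (aemeasurable_pi_lambda _ fun j => hδ j) hZ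
    ?_ ?_
  · have hφ : Measurable fun f : ({k} : Finset ℕ) → E => f ⟨k, Finset.mem_singleton_self k⟩ :=
      measurable_pi_apply _
    exact (hind.indepFun_finset₀ {k} (Finset.range k) (by simp) hδ).comp hφ measurable_id
  · have hφ : Measurable fun f : ℕ → E => (f k, fun j : Finset.range k => f j) := by fun_prop
    exact h.comp hφ measurable_id

variable {n d : ℕ} {X : Matrix (Fin n) (Fin d) ℝ}

lemma dropoutIterate_congr (α : ℝ) (y : Fin n → ℝ) (b₀ : Fin d → ℝ) {δ δ' : ℕ → Fin d → ℝ} {k : ℕ}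
    (h : ∀ j < k, δ j = δ' j) : dropoutIterate X α y b₀ δ k = dropoutIterate X α y b₀ δ' k := by
  induction k with
  | zero => rfl
  | succ k ih =>
    simp only [dropoutIterate]
    rw [ih fun j hj => h j (hj.trans k.lt_succ_self), h k k.lt_succ_self]

lemma continuous_dropoutIterate (α : ℝ) (k : ℕ) :
    Continuous fun q : (ℕ → Fin d → ℝ) × (Fin n → ℝ) × (Fin d → ℝ) =>
      dropoutIterate X α q.2.1 q.2.2 q.1 k := by
  induction k with
  | zero => simp only [dropoutIterate]; fun_prop
  | succ k ih => simp only [dropoutIterate]; fun_prop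

lemma indepFun_dropoutIterate {δ : ℕ → Ω → Fin d → ℝ} {Y : Ω → Fin n → ℝ} {β₀ : Ω → Fin d → ℝ}
    (hδ : ∀ k, AEMeasurable (δ k) μ) (hY : AEMeasurable Y μ) (hβ : AEMeasurable β₀ μ)
    (hind : iIndepFun δ μ) (h : IndepFun (fun ω k => δ k ω) (fun ω => (Y ω, β₀ ω)) μ)
    (α : ℝ) (k : ℕ) :
    IndepFun (δ k)
      (fun ω => (dropoutIterate X α (Y ω) (β₀ ω) (fun j => δ j ω) k, Y ω)) μ := by
  let extend (g : Finset.range k → Fin d → ℝ) (j : ℕ) : Fin d → ℝ :=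
    if hj : j ∈ Finset.range k then g ⟨j, hj⟩ else 0
  have hextend : Measurable extend := by
    refine measurable_pi_lambda _ fun j => ?_
    by_cases hj : j ∈ Finset.range k
    · simpa only [extend, hj, dif_pos] using measurable_pi_apply _
    · simpa only [extend, hj, dif_neg, not_false_eq_true] using measurable_const
  have hiterate ω : dropoutIterate X α (Y ω) (β₀ ω) (fun j => δ j ω) k
      = dropoutIterate X α (Y ω) (β₀ ω) (extend fun j => δ j ω) k :=
    dropoutIterate_congr α _ _ fun j hj => by simp [extend, hj]
  have hψ : Measurable fun q : (Finset.range k → Fin d → ℝ) × (Fin n → ℝ) × (Fin d → ℝ) =>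
      (dropoutIterate X α q.2.1 q.2.2 (extend q.1) k, q.2.1) :=
    ((continuous_dropoutIterate α k).measurable.comp
      ((hextend.comp measurable_fst).prodMk measurable_snd)).prodMk (by fun_prop)
  simp only [hiterate]
  exact (indepFun_history hδ (hY.prodMk hβ) hind h k).comp measurable_id hψ

end History

section Recursion

variable {n d : ℕ} {X : Matrix (Fin n) (Fin d) ℝ} {p : unitInterval} {m : ℝ}
  {b : (Fin n → ℝ) → (Fin d → ℝ)} {Ω : Type*} [MeasurableSpace Ω] {μ : Measure Ω}
  {Y : Ω → Fin n → ℝ}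

lemma minimizer_eq (hm₀ : 0 < m) (hm : ∀ i, m ≤ gram X i i) (hp₀ : 0 < p) (hp₁ : p < 1)
    (hb : IsMarginalizedLossMinimizer X p b) (y : Fin n → ℝ) :
    b y = ((offDiagScale p (gram X))⁻¹ * Xᵀ) *ᵥ y := by
  have hq : 0 < 1 - (p : ℝ) := sub_pos.2 hp₁
  have hpos : (offDiagScale p (gram X)).PosDef := by
    refine Matrix.PosDef.of_dotProduct_mulVec_pos
      (offDiagScale_isSymm (gram_isSymm X) p) fun u hu => ?_
    have hu' : 0 < u ⬝ᵥ u := (dotProduct_self_nonneg u).lt_of_ne' (by simpa using hu)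
    rw [star_trivial]
    exact (by positivity : 0 < (1 - (p : ℝ)) * m * (u ⬝ᵥ u)).trans_le
      (mul_dotProduct_self_le_dotProduct_offDiagScale_gram_mulVec hm u)
  rw [← Matrix.mulVec_mulVec, ← offDiagScale_gram_mulVec_minimizer hp₀ hb y, Matrix.mulVec_mulVec,
    Matrix.nonsing_inv_mul _ hpos.det_pos.ne'.isUnit, Matrix.one_mulVec]

lemma memLp_minimizer (hm₀ : 0 < m) (hm : ∀ i, m ≤ gram X i i) (hp₀ : 0 < p) (hp₁ : p < 1)
    (hb : IsMarginalizedLossMinimizer X p b) (hY : MemLp Y 2 μ) :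
    MemLp (fun ω => b (Y ω)) 2 μ := by
  simp only [minimizer_eq hm₀ hm hp₀ hp₁ hb]
  exact memLp_mulVec _ hY

lemma integral_minimizer_dotProduct_self_le (hm₀ : 0 < m) (hm : ∀ i, m ≤ gram X i i)
    (hp₀ : 0 < p) (hp₁ : p < 1) (hb : IsMarginalizedLossMinimizer X p b) (hY : MemLp Y 2 μ) :
    ∫ ω, b (Y ω) ⬝ᵥ b (Y ω) ∂μ
      ≤ (∫ ω, (Xᵀ *ᵥ Y ω) ⬝ᵥ (Xᵀ *ᵥ Y ω) ∂μ) / m ^ 2 / (1 - p) ^ 2 := by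
  have hV := memLp_minimizer hm₀ hm hp₀ hp₁ hb hY
  have hq : 0 < 1 - (p : ℝ) := sub_pos.2 hp₁
  rw [div_div, le_div_iff₀ (by positivity), ← integral_mul_const]
  refine integral_mono ((integrable_dotProduct hV hV).mul_const _)
    (integrable_dotProduct (memLp_mulVec _ hY) (memLp_mulVec _ hY)) fun ω => ?_
  have h := sq_mul_dotProduct_self_le (by positivity)
    (mul_dotProduct_self_le_dotProduct_offDiagScale_gram_mulVec (p := p) hm (b (Y ω)))
  rw [offDiagScale_gram_mulVec_minimizer hp₀ hb] at h
  dsimp only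
  linarith

/-- The random inputs of gradient descent with dropout: square integrable observation `Y` and
initialization `β₀`, which may depend on each other, and dropout diagonals `δ k` that are
independent of each other and of the pair `(Y, β₀)`. -/
structure IsDropoutInput (p : unitInterval) (Y : Ω → Fin n → ℝ) (β₀ : Ω → Fin d → ℝ)
    (δ : ℕ → Ω → Fin d → ℝ) (μ : Measure Ω) : Prop where
  memLp_observation : MemLp Y 2 μ
  memLp_initial : MemLp β₀ 2 μ
  hasLaw : ∀ k, HasLaw (δ k) (dropoutLaw d p) μ
  iIndepFun : iIndepFun δ μ
  indepFun : IndepFun (fun ω k => δ k ω) (fun ω => (Y ω, β₀ ω)) μ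

lemma isAffineRecursion_dropoutIterate_sub_minimizer [IsProbabilityMeasure μ] (hm₀ : 0 < m)
    (hm : ∀ i, m ≤ gram X i i) (hp₀ : 0 < p) (hp₁ : p < 1)
    (hb : IsMarginalizedLossMinimizer X p b) {β₀ : Ω → Fin d → ℝ} {δ : ℕ → Ω → Fin d → ℝ}
    (h : IsDropoutInput p Y β₀ δ μ) (α : ℝ) :
    IsAffineRecursion (errorCoeff α (gram X)) (errorForcing α p (gram X)) (dropoutLaw d p) δ
      (fun k ω => dropoutIterate X α (Y ω) (β₀ ω) (fun j => δ j ω) k - b (Y ω))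
      (fun ω => b (Y ω)) μ where
  memLp_coeff := memLp_top_dropoutLaw (continuous_errorCoeff α _)
  memLp_forcing := memLp_top_dropoutLaw (continuous_errorForcing α p _)
  integral_forcing := integral_errorForcing α _
  hasLaw := h.hasLaw
  indepFun k := by
    have hφ : Measurable fun x : (Fin d → ℝ) × (Fin n → ℝ) => (x.1 - b x.2, b x.2) := by
      simp only [minimizer_eq hm₀ hm hp₀ hp₁ hb]
      fun_prop
    exact (indepFun_dropoutIterate (fun k => (h.hasLaw k).aemeasurable)
      h.memLp_observation.aestronglyMeasurable.aemeasurable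
      h.memLp_initial.aestronglyMeasurable.aemeasurable h.iIndepFun h.indepFun α k).comp
        measurable_id hφ
  memLp_zero := h.memLp_initial.sub (memLp_minimizer hm₀ hm hp₀ hp₁ hb h.memLp_observation)
  memLp_right := memLp_minimizer hm₀ hm hp₀ hp₁ hb h.memLp_observation
  step k := by
    filter_upwards [ae_of_ae_map (h.hasLaw k).aemeasurable
      ((h.hasLaw k).map_eq.symm ▸ ae_diagonal_mul_self)] with ω hω
    exact dropout_step_sub hω α p (offDiagScale_gram_mulVec_minimizer hp₀ hb (Y ω)) _

end Recursion

section StepSize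

variable {d : ℕ} {p : unitInterval} {α : ℝ} {G : Matrix (Fin d) (Fin d) ℝ}

lemma two_mul_sq_mul_norm_mul_norm_offDiag_le (hα : 0 ≤ α) (hαG : α * ‖G‖ ≤ 1) :
    2 * (α ^ 2 * ‖G‖ * ‖offDiag G‖) ≤ 4 := by
  calc 2 * (α ^ 2 * ‖G‖ * ‖offDiag G‖) ≤ 2 * (α ^ 2 * ‖G‖ * (2 * ‖G‖)) := by
        gcongr
        exact norm_offDiag_le G
    _ = 4 * (α * ‖G‖) ^ 2 := by ring
    _ ≤ 4 * 1 ^ 2 := by gcongr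
    _ = 4 := by norm_num

variable [NeZero d]

lemma mul_norm_le_one_of_mul_sq_norm_le_lambdaMin (hG : (offDiagScale p G).IsHermitian)
    (hαG : α * ‖G‖ ^ 2 ≤ lambdaMin (offDiagScale p G)) : α * ‖G‖ ≤ 1 := by
  rcases (norm_nonneg G).eq_or_lt with hG₀ | hG₀
  · rw [← hG₀, mul_zero]
    exact zero_le_one
  · refine le_of_mul_le_mul_right ?_ hG₀
    calc α * ‖G‖ * ‖G‖ = α * ‖G‖ ^ 2 := by ring
      _ ≤ ‖offDiagScale p G‖ := hαG.trans (lambdaMin_le_norm hG)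
      _ ≤ 1 * ‖G‖ := (norm_offDiagScale_le p G).trans_eq (one_mul _).symm

lemma norm_one_sub_smul_offDiagScale_le_two (hα : 0 ≤ α) (hαG : α * ‖G‖ ≤ 1) :
    ‖1 - (α * p) • offDiagScale p G‖ ≤ 2 := by
  have hαp : α * p * ‖offDiagScale p G‖ ≤ 1 := by
    calc α * p * ‖offDiagScale p G‖ ≤ α * 1 * ‖G‖ := by
          gcongr
          · exact p.2.2
          · exact norm_offDiagScale_le p G
      _ ≤ 1 := by rwa [mul_one]
  calc ‖1 - (α * p) • offDiagScale p G‖ ≤ ‖(1 : Matrix (Fin d) (Fin d) ℝ)‖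
        + ‖(α * p) • offDiagScale p G‖ := norm_sub_le _ _
    _ ≤ 2 := by
      rw [norm_one, norm_smul, Real.norm_of_nonneg (mul_nonneg hα p.2.1)]
      linarith

lemma norm_crossCov_dropout_recursion_sub_le {Ω : Type*} [MeasurableSpace Ω] {μ : Measure Ω}
    [IsProbabilityMeasure μ] {δ : ℕ → Ω → Fin d → ℝ} {U : ℕ → Ω → Fin d → ℝ} {V : Ω → Fin d → ℝ}
    (h : IsAffineRecursion (errorCoeff α G) (errorForcing α p G) (dropoutLaw d p) δ U V μ)
    (hG : (offDiagScale p G).IsHermitian) {m : ℝ} (hm₀ : 0 < m)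
    (hm : (1 - p) * m ≤ lambdaMin (offDiagScale p G)) (hα : 0 ≤ α)
    (hαG : α * ‖G‖ ^ 2 ≤ lambdaMin (offDiagScale p G)) {T : ℝ}
    (hU : ∫ ω, U 0 ω ⬝ᵥ U 0 ω ∂μ ≤ T) (hV : ∫ ω, V ω ⬝ᵥ V ω ∂μ ≤ T) {k : ℕ} (hk : 1 ≤ k) :
    ‖crossCov (fun ω => U k ω + V ω) (fun ω => U k ω + V ω) μ - crossCov V V μ‖
      ≤ k * ‖1 - (α * p) • offDiagScale p G‖ ^ (k - 1) * (10 * T)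
        + α * p * (‖offDiag G‖ ^ 2 / m) * T := by
  set l := lambdaMin (offDiagScale p G)
  have hp : 0 ≤ (p : ℝ) := p.2.1
  have hq : 0 ≤ 1 - (p : ℝ) := sub_nonneg.2 p.2.2
  have hT : 0 ≤ T := (integral_dotProduct_self_nonneg V).trans hV
  have hαG₁ := mul_norm_le_one_of_mul_sq_norm_le_lambdaMin hG hαG
  have hcoeff (u : Fin d → ℝ) := (dotProduct_integral_errorCoeff_mulVec_le hα
    (lambdaMin_mul_le_dotProduct_mulVec hG) u).trans (mul_le_mul_of_nonneg_right
      (by linarith [mul_le_mul_of_nonneg_left hαG (mul_nonneg hα hp)] :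
        1 - 2 * α * p * l + α ^ 2 * p * ‖G‖ ^ 2 ≤ 1 - α * p * l) (dotProduct_self_nonneg u))
  have hr : 0 ≤ 1 - α * p * l := by
    have hl : l ≤ ‖G‖ := (lambdaMin_le_norm hG).trans (norm_offDiagScale_le p G)
    have hl₀ : 0 ≤ l := (mul_nonneg hq hm₀.le).trans hm
    have : α * p * l ≤ α * 1 * ‖G‖ := by
      gcongr
      exact p.2.2
    linarith
  have hforcing : α ^ 2 * (p ^ 2 * (1 - p)) * ‖offDiag G‖ ^ 2 * T
      ≤ (1 - (1 - α * p * l)) * (α * p * (‖offDiag G‖ ^ 2 / m) * T) := by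
    calc _ = α ^ 2 * p ^ 2 * ((1 - p) * m) * (‖offDiag G‖ ^ 2 / m) * T := by field_simp
      _ ≤ α ^ 2 * p ^ 2 * l * (‖offDiag G‖ ^ 2 / m) * T := by gcongr
      _ = _ := by ring
  have hbound := h.norm_crossCov_add_self_sub_le hcoeff
    (dotProduct_integral_errorForcing_mulVec_le α G) (by positivity)
    (norm_integral_errorForcing_transpose_mul_errorCoeff_le α G) hU hV hr
    (by rw [integral_errorCoeff]; exact one_sub_mul_lambdaMin_le_norm hG _) hforcing
    (by positivity) hk
  rw [integral_errorCoeff] at hbound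
  refine hbound.trans ?_
  gcongr
  -- `10 = 3 * 2 + 4`, from `‖1 - α p G_p‖ ≤ 2` and `2 α² ‖G‖ ‖G - Diag(G)‖ ≤ 4`
  linarith [norm_one_sub_smul_offDiagScale_le_two (p := p) hα hαG₁,
    two_mul_sq_mul_norm_mul_norm_offDiag_le hα hαG₁]

end StepSize

section LeastSquares

variable {n d : ℕ} {X : Matrix (Fin n) (Fin d) ℝ} {p : unitInterval}

lemma one_add_smul_mulVec_eq_diagPart_inv_mulVec {G : Matrix (Fin d) (Fin d) ℝ}
    (hG : ∀ i, G i i ≠ 0) (t : ℝ) (v : Fin d → ℝ) :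
    (1 + t • ((diagPart G)⁻¹ * offDiag G)) *ᵥ v
      = (diagPart G)⁻¹ *ᵥ (offDiagScale t G *ᵥ v) := by
  have hdet : IsUnit (diagPart G).det := by
    rw [diagPart, Matrix.det_diagonal, isUnit_iff_ne_zero]
    exact Finset.prod_ne_zero_iff.2 fun i _ => hG i
  rw [Matrix.mulVec_mulVec, offDiagScale_eq_diagPart_add, mul_add, Matrix.nonsing_inv_mul _ hdet,
    Matrix.mul_smul]

lemma norm_covMatrix_minimizer_sub_le {m : ℝ} (hm₀ : 0 < m) (hm : ∀ i, m ≤ gram X i i)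
    (hp₀ : 0 < p) (hp₁ : p < 1) {b : (Fin n → ℝ) → (Fin d → ℝ)}
    (hb : IsMarginalizedLossMinimizer X p b) {Ω : Type*} [MeasurableSpace Ω] {μ : Measure Ω}
    [IsProbabilityMeasure μ] {Y : Ω → Fin n → ℝ} (hY : MemLp Y 2 μ) (hYcov : covMatrix Y μ = 1)
    {T : ℝ} (hbT : ∫ ω, b (Y ω) ⬝ᵥ b (Y ω) ∂μ ≤ T) :
    ‖covMatrix (fun ω => b (Y ω)) μ
        - (diagPart (gram X))⁻¹ * gram X * (diagPart (gram X))⁻¹‖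
      ≤ p * (2 * ‖(diagPart (gram X))⁻¹ * offDiag (gram X)‖
        + ‖(diagPart (gram X))⁻¹ * offDiag (gram X)‖ ^ 2) * T := by
  set E := (diagPart (gram X))⁻¹
  have hV := memLp_minimizer hm₀ hm hp₀ hp₁ hb hY
  have hET : Eᵀ = E := by
    rw [Matrix.transpose_nonsing_inv, diagPart, Matrix.diagonal_transpose, ← diagPart]
  have hmodel ω : (E * Xᵀ) *ᵥ Y ω = (1 + (p : ℝ) • (E * offDiag (gram X))) *ᵥ b (Y ω) := by
    rw [one_add_smul_mulVec_eq_diagPart_inv_mulVec fun i => (hm₀.trans_le (hm i)).ne',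
      offDiagScale_gram_mulVec_minimizer hp₀ hb, Matrix.mulVec_mulVec]
  have hcov : E * gram X * E = (1 + (p : ℝ) • (E * offDiag (gram X)))
      * covMatrix (fun ω => b (Y ω)) μ * (1 + (p : ℝ) • (E * offDiag (gram X)))ᵀ := by
    calc E * gram X * E = (E * Xᵀ) * crossCov Y Y μ * (E * Xᵀ)ᵀ := by
          rw [show crossCov Y Y μ = 1 from hYcov, Matrix.mul_one, Matrix.transpose_mul, hET,
            Matrix.transpose_transpose, gram]
          simp only [Matrix.mul_assoc]
      _ = _ := by
          rw [← crossCov_mulVec_self _ hY]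
          simp only [hmodel]
          exact crossCov_mulVec_self _ hV
  rw [hcov, norm_sub_rev]
  refine (norm_one_add_smul_mul_mul_transpose_sub_le p.2.1 p.2.2 _ _).trans ?_
  have hp := p.2.1
  gcongr
  exact norm_crossCov_le hV hV hbT hbT

end LeastSquares

section Bounds

variable {n d : ℕ} {X : Matrix (Fin n) (Fin d) ℝ} {p : unitInterval} {α m T : ℝ}
  {b : (Fin n → ℝ) → (Fin d → ℝ)} {Ω : Type*} [MeasurableSpace Ω] {μ : Measure Ω}
  {Y : Ω → Fin n → ℝ} {β₀ : Ω → Fin d → ℝ}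

lemma integral_minimizer_dotProduct_self_le_div (hm₀ : 0 < m) (hm : ∀ i, m ≤ gram X i i)
    (hp₀ : 0 < p) (hp₁ : p < 1) (hb : IsMarginalizedLossMinimizer X p b) (hY : MemLp Y 2 μ)
    (hT : 2 * (∫ ω, β₀ ω ⬝ᵥ β₀ ω ∂μ
      + (∫ ω, (Xᵀ *ᵥ Y ω) ⬝ᵥ (Xᵀ *ᵥ Y ω) ∂μ) / m ^ 2) ≤ T) :
    ∫ ω, b (Y ω) ⬝ᵥ b (Y ω) ∂μ ≤ T / (1 - p) ^ 2 := by
  refine (integral_minimizer_dotProduct_self_le hm₀ hm hp₀ hp₁ hb hY).trans ?_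
  have hβ := integral_dotProduct_self_nonneg (μ := μ) β₀
  have hXY : 0 ≤ (∫ ω, (Xᵀ *ᵥ Y ω) ⬝ᵥ (Xᵀ *ᵥ Y ω) ∂μ) / m ^ 2 :=
    div_nonneg (integral_dotProduct_self_nonneg _) (sq_nonneg m)
  gcongr
  linarith

lemma integral_sub_minimizer_dotProduct_self_le_div (hm₀ : 0 < m) (hm : ∀ i, m ≤ gram X i i)
    (hp₀ : 0 < p) (hp₁ : p < 1) (hb : IsMarginalizedLossMinimizer X p b) (hY : MemLp Y 2 μ)
    (hβ : MemLp β₀ 2 μ)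
    (hT : 2 * (∫ ω, β₀ ω ⬝ᵥ β₀ ω ∂μ
      + (∫ ω, (Xᵀ *ᵥ Y ω) ⬝ᵥ (Xᵀ *ᵥ Y ω) ∂μ) / m ^ 2) ≤ T) :
    ∫ ω, (β₀ ω - b (Y ω)) ⬝ᵥ (β₀ ω - b (Y ω)) ∂μ ≤ T / (1 - p) ^ 2 := by
  have hq : 0 < 1 - (p : ℝ) := sub_pos.2 hp₁
  have hβ₀ : ∫ ω, β₀ ω ⬝ᵥ β₀ ω ∂μ ≤ (∫ ω, β₀ ω ⬝ᵥ β₀ ω ∂μ) / (1 - p) ^ 2 :=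
    le_div_self (integral_dotProduct_self_nonneg β₀) (by positivity)
      (pow_le_one₀ hq.le (sub_le_self _ p.2.1))
  calc _ ≤ 2 * ∫ ω, β₀ ω ⬝ᵥ β₀ ω ∂μ + 2 * ∫ ω, b (Y ω) ⬝ᵥ b (Y ω) ∂μ :=
        integral_sub_dotProduct_sub_self_le hβ (memLp_minimizer hm₀ hm hp₀ hp₁ hb hY)
    _ ≤ 2 * (∫ ω, β₀ ω ⬝ᵥ β₀ ω ∂μ + (∫ ω, (Xᵀ *ᵥ Y ω) ⬝ᵥ (Xᵀ *ᵥ Y ω) ∂μ) / m ^ 2)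
        / (1 - p) ^ 2 := by
      rw [mul_div_assoc, add_div]
      linarith [integral_minimizer_dotProduct_self_le hm₀ hm hp₀ hp₁ hb hY]
    _ ≤ T / (1 - p) ^ 2 := by gcongr

variable [IsProbabilityMeasure μ] [NeZero d] {δ : ℕ → Ω → Fin d → ℝ} {k : ℕ}

lemma norm_covMatrix_dropoutIterate_sub_minimizer_le (hm₀ : 0 < m) (hm : ∀ i, m ≤ gram X i i)
    (hp₀ : 0 < p) (hp₁ : p < 1) (hb : IsMarginalizedLossMinimizer X p b)
    (h : IsDropoutInput p Y β₀ δ μ) (hα : 0 ≤ α)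
    (hαX : α * ‖gram X‖ ^ 2 ≤ lambdaMin (offDiagScale p (gram X)))
    (hβT : ∫ ω, (β₀ ω - b (Y ω)) ⬝ᵥ (β₀ ω - b (Y ω)) ∂μ ≤ T)
    (hbT : ∫ ω, b (Y ω) ⬝ᵥ b (Y ω) ∂μ ≤ T) (hk : 1 ≤ k) :
    ‖covMatrix (fun ω => dropoutIterate X α (Y ω) (β₀ ω) (fun j => δ j ω) k) μ
        - covMatrix (fun ω => b (Y ω)) μ‖
      ≤ k * ‖1 - (α * p) • offDiagScale p (gram X)‖ ^ (k - 1) * (10 * T)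
        + α * p * (‖offDiag (gram X)‖ ^ 2 / m) * T := by
  have hherm : (offDiagScale p (gram X)).IsHermitian := offDiagScale_isSymm (gram_isSymm X) p
  have hbound := norm_crossCov_dropout_recursion_sub_le
    (isAffineRecursion_dropoutIterate_sub_minimizer hm₀ hm hp₀ hp₁ hb h α) hherm hm₀
    (le_lambdaMin hherm (mul_dotProduct_self_le_dotProduct_offDiagScale_gram_mulVec hm)) hα hαX
    hβT hbT hk
  simp only [sub_add_cancel] at hbound
  exact hbound

/-- The part of the constant `C''` that depends on the Gram matrix `A` and a lower bound `m` for its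
diagonal: the first summand is due to the forcing by the dropout noise, the others to the
distance between `β̃` and `Diag(A)⁻¹ Xᵀ Y`. -/
noncomputable def designConst {d : ℕ} (A : Matrix (Fin d) (Fin d) ℝ) (m : ℝ) : ℝ :=
  ‖offDiag A‖ ^ 2 / m
    + (2 * ‖(diagPart A)⁻¹ * offDiag A‖ + ‖(diagPart A)⁻¹ * offDiag A‖ ^ 2)

lemma norm_covMatrix_dropoutIterate_sub_le (hm₀ : 0 < m) (hm : ∀ i, m ≤ gram X i i)
    (hp₀ : 0 < p) (hp₁ : p < 1) (hb : IsMarginalizedLossMinimizer X p b)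
    (h : IsDropoutInput p Y β₀ δ μ) (hYcov : covMatrix Y μ = 1) (hα : 0 ≤ α)
    (hαX : α * ‖gram X‖ ^ 2 ≤ lambdaMin (offDiagScale p (gram X)))
    (hT : 2 * (∫ ω, β₀ ω ⬝ᵥ β₀ ω ∂μ
      + (∫ ω, (Xᵀ *ᵥ Y ω) ⬝ᵥ (Xᵀ *ᵥ Y ω) ∂μ) / m ^ 2) ≤ T)
    (hk : 1 ≤ k) :
    ‖covMatrix (fun ω => dropoutIterate X α (Y ω) (β₀ ω) (fun j => δ j ω) k) μ
        - covMatrix (fun ω => b (Y ω)) μ‖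
      ≤ (k * ‖1 - (α * p) • offDiagScale p (gram X)‖ ^ (k - 1) * (10 * T)
        + α * p * (designConst (gram X) m * T)) / (1 - p) ^ 2 ∧
    ‖covMatrix (fun ω => dropoutIterate X α (Y ω) (β₀ ω) (fun j => δ j ω) k) μ
        - (diagPart (gram X))⁻¹ * gram X * (diagPart (gram X))⁻¹‖
      ≤ (k * ‖1 - (α * p) • offDiagScale p (gram X)‖ ^ (k - 1) * (10 * T)
        + p * (1 + α) * (designConst (gram X) m * T)) / (1 - p) ^ 2 := by
  have hY := h.memLp_observation
  have hbT := integral_minimizer_dotProduct_self_le_div hm₀ hm hp₀ hp₁ hb hY hT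
  have hfirst := norm_covMatrix_dropoutIterate_sub_minimizer_le hm₀ hm hp₀ hp₁ hb h hα hαX
    (integral_sub_minimizer_dotProduct_self_le_div hm₀ hm hp₀ hp₁ hb hY h.memLp_initial hT) hbT hk
  have hsecond := norm_covMatrix_minimizer_sub_le hm₀ hm hp₀ hp₁ hb hY hYcov hbT
  have hT₀ := (integral_dotProduct_self_nonneg _).trans hbT
  have hp : 0 ≤ (p : ℝ) := p.2.1
  set r := (k : ℝ) * ‖1 - (α * p) • offDiagScale p (gram X)‖ ^ (k - 1)
  set c₁ := ‖offDiag (gram X)‖ ^ 2 / m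
  set c₂ := 2 * ‖(diagPart (gram X))⁻¹ * offDiag (gram X)‖
    + ‖(diagPart (gram X))⁻¹ * offDiag (gram X)‖ ^ 2
  set T' := T / (1 - (p : ℝ)) ^ 2 with hT'
  have hc₁ : 0 ≤ c₁ := by positivity
  have hc₂ : 0 ≤ c₂ := by positivity
  have hdiv (s : ℝ) : (r * (10 * T) + s * (designConst (gram X) m * T)) / (1 - (p : ℝ)) ^ 2
      = r * (10 * T') + s * (c₁ + c₂) * T' := by rw [designConst, hT']; ring
  have hpc₁ : 0 ≤ p * c₁ * T' := mul_nonneg (mul_nonneg hp hc₁) hT₀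
  have hpc₂ : 0 ≤ α * p * c₂ * T' :=
    mul_nonneg (mul_nonneg (mul_nonneg hα hp) hc₂) hT₀
  rw [hdiv, hdiv]
  refine ⟨by linarith, ?_⟩
  linarith [norm_sub_le_norm_sub_add_norm_sub
    (covMatrix (fun ω => dropoutIterate X α (Y ω) (β₀ ω) (fun j => δ j ω) k) μ)
    (covMatrix (fun ω => b (Y ω)) μ)
    ((diagPart (gram X))⁻¹ * gram X * (diagPart (gram X))⁻¹)]

end Bounds

lemma neZero_of_norm_pos {d : ℕ} {A : Matrix (Fin d) (Fin d) ℝ} (hA : 0 < ‖A‖) : NeZero d := by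
  refine ⟨fun hd => hA.ne' ?_⟩
  subst hd
  rw [Subsingleton.elim A 0, norm_zero]

lemma memLp_of_hasLaw {Ω ι : Type*} [MeasurableSpace Ω] [Fintype ι] {μ : Measure Ω}
    {ρ : Measure (ι → ℝ)} {Z : Ω → ι → ℝ} (hZ : HasLaw Z ρ μ) {q : ENNReal}
    (h : ∀ i, MemLp (fun z : ι → ℝ => z i) q ρ) : MemLp Z q μ :=
  MemLp.of_eval fun i => (hZ.map_eq.symm ▸ h i).comp_of_map hZ.aemeasurable

lemma covMatrix_eq_of_hasLaw {Ω : Type*} [MeasurableSpace Ω] {n : ℕ} {μ : Measure Ω}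
    {ρ : Measure (Fin n → ℝ)} {Z : Ω → Fin n → ℝ} (hZ : HasLaw Z ρ μ) :
    covMatrix Z μ = covMatrix (fun z => z) ρ := by
  ext i j
  exact hZ.covariance_fun_comp (measurable_pi_apply i).aemeasurable
    (measurable_pi_apply j).aemeasurable

end Dropout

theorem mainTheorem7_general {n d : ℕ} (X : Matrix (Fin n) (Fin d) ℝ)
    (hX : ∀ j, ∃ i, X i j ≠ 0)
    (βstar : Fin d → ℝ)
    (ν : Measure (Fin n → ℝ))
    (hν_sq : ∀ i, MemLp (fun e : Fin n → ℝ => e i) 2 ν)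
    (hν_cov : Dropout.covMatrix (fun e : Fin n → ℝ => e) ν = 1)
    (π : Measure (Fin d → ℝ))
    (hπ_sq : ∀ i, MemLp (fun b : Fin d → ℝ => b i) 2 π) :
    ∃ C' C'' : ℝ, ∀ (α : ℝ) (p : unitInterval), 0 < α → 0 < p → p < 1 →
      α ≤ Dropout.lambdaMin (Dropout.offDiagScale p (Dropout.gram X))
        / ‖Dropout.gram X‖ ^ 2 →
      ∀ (Ω : Type*) [MeasurableSpace Ω] (μ : Measure Ω) [IsProbabilityMeasure μ]
        (ε Y : Ω → Fin n → ℝ) (β₀ : Ω → Fin d → ℝ) (δ : ℕ → Ω → Fin d → ℝ)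
        (b : (Fin n → ℝ) → (Fin d → ℝ)),
        HasLaw ε ν μ →
        (∀ ω, Y ω = X *ᵥ βstar + ε ω) →
        HasLaw β₀ π μ →
        (∀ k, HasLaw (δ k) (Dropout.dropoutLaw d p) μ) →
        iIndepFun δ μ →
        IndepFun (fun ω k => δ k ω) (fun ω => (Y ω, β₀ ω)) μ →
        Dropout.IsMarginalizedLossMinimizer X p b →
        ∀ k : ℕ, 1 ≤ k →
          ‖Dropout.covMatrix
                (fun ω => Dropout.dropoutIterate X α (Y ω) (β₀ ω) (fun j => δ j ω) k) μ
              - Dropout.covMatrix (fun ω => b (Y ω)) μ‖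
            ≤ (k * ‖1 - (α * p) • Dropout.offDiagScale p (Dropout.gram X)‖ ^ (k - 1) * C'
                + α * p * C'') / (1 - p) ^ 2 ∧
          ‖Dropout.covMatrix
                (fun ω => Dropout.dropoutIterate X α (Y ω) (β₀ ω) (fun j => δ j ω) k) μ
              - (Dropout.diagPart (Dropout.gram X))⁻¹ * Dropout.gram X
                * (Dropout.diagPart (Dropout.gram X))⁻¹‖
            ≤ (k * ‖1 - (α * p) • Dropout.offDiagScale p (Dropout.gram X)‖ ^ (k - 1) * C'
                + p * (1 + α) * C'') / (1 - p) ^ 2 := by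
  obtain ⟨m, hm₀, hm⟩ := Dropout.exists_forall_le_gram_apply_self X hX
  obtain ⟨T, hT⟩ : ∃ T, T = 2 * (∫ c, c ⬝ᵥ c ∂π
      + (∫ e, (Xᵀ *ᵥ (X *ᵥ βstar + e)) ⬝ᵥ (Xᵀ *ᵥ (X *ᵥ βstar + e)) ∂ν) / m ^ 2) := ⟨_, rfl⟩
  refine ⟨10 * T, Dropout.designConst (Dropout.gram X) m * T,
    fun α p hα hp₀ hp₁ hαX Ω _ μ _ ε Y β₀ δ b hε hYε hβ hδ hind hindep hb k hk => ?_⟩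
  have hX₀ : 0 < ‖Dropout.gram X‖ := by
    refine (norm_nonneg _).lt_of_ne fun h => hα.not_ge ?_
    rwa [← h, sq, mul_zero, div_zero] at hαX
  have : NeZero d := Dropout.neZero_of_norm_pos hX₀
  have hε_sq : MemLp ε 2 μ := Dropout.memLp_of_hasLaw hε hν_sq
  obtain rfl : Y = fun ω => X *ᵥ βstar + ε ω := funext hYε
  have hYcov : Dropout.covMatrix (fun ω => X *ᵥ βstar + ε ω) μ = 1 :=
    (Dropout.crossCov_const_add_self _ hε_sq).trans
      ((Dropout.covMatrix_eq_of_hasLaw hε).trans hν_cov)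
  have hβ_int : ∫ ω, β₀ ω ⬝ᵥ β₀ ω ∂μ = ∫ c, c ⬝ᵥ c ∂π :=
    hβ.integral_comp (f := fun c => c ⬝ᵥ c) (by fun_prop)
  have hY_int : ∫ ω, (Xᵀ *ᵥ (X *ᵥ βstar + ε ω)) ⬝ᵥ (Xᵀ *ᵥ (X *ᵥ βstar + ε ω)) ∂μ
      = ∫ e, (Xᵀ *ᵥ (X *ᵥ βstar + e)) ⬝ᵥ (Xᵀ *ᵥ (X *ᵥ βstar + e)) ∂ν :=
    hε.integral_comp
      (f := fun e => (Xᵀ *ᵥ (X *ᵥ βstar + e)) ⬝ᵥ (Xᵀ *ᵥ (X *ᵥ βstar + e))) (by fun_prop)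
  rw [← hβ_int, ← hY_int] at hT
  have hin : Dropout.IsDropoutInput p (fun ω => X *ᵥ βstar + ε ω) β₀ δ μ :=
    ⟨(memLp_const (X *ᵥ βstar)).add hε_sq, Dropout.memLp_of_hasLaw hβ hπ_sq, hδ, hind, hindep⟩
  exact Dropout.norm_covMatrix_dropoutIterate_sub_le hm₀ hm hp₀ hp₁ hb hin hYcov hα.le
    ((le_div_iff₀ (by positivity)).1 hαX) hT.ge hk

/-- `ν` is the law of the regression noise and `π` the law of the initialization; the constants
depend only on the design, the regression vector and these two laws. -/
theorem mainTheorem7 {n d : ℕ} (X : Matrix (Fin n) (Fin d) ℝ)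
    (hX : ∀ j, ∃ i, X i j ≠ 0)
    (βstar : Fin d → ℝ)
    (ν : Measure (Fin n → ℝ)) [IsProbabilityMeasure ν]
    (hν_sq : ∀ i, MemLp (fun e : Fin n → ℝ => e i) 2 ν)
    (hν_mean : ∀ i, ∫ e, e i ∂ν = 0)
    (hν_cov : Dropout.covMatrix (fun e : Fin n → ℝ => e) ν = 1)
    (π : Measure (Fin d → ℝ)) [IsProbabilityMeasure π]
    (hπ_sq : ∀ i, MemLp (fun b : Fin d → ℝ => b i) 2 π) :
    ∃ C' C'' : ℝ, ∀ (α : ℝ) (p : unitInterval), 0 < α → 0 < p → p < 1 →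
      α * p * ‖Dropout.gram X‖ < 1 →
      α < Dropout.lambdaMin (Dropout.offDiagScale p (Dropout.gram X))
        / (3 * ‖Dropout.gram X‖ ^ 2) →
      ∀ (Ω : Type*) [MeasurableSpace Ω] (μ : Measure Ω) [IsProbabilityMeasure μ]
        (ε Y : Ω → Fin n → ℝ) (β₀ : Ω → Fin d → ℝ) (δ : ℕ → Ω → Fin d → ℝ)
        (b : (Fin n → ℝ) → (Fin d → ℝ)),
        HasLaw ε ν μ →
        (∀ ω, Y ω = X *ᵥ βstar + ε ω) →
        HasLaw β₀ π μ →
        IndepFun β₀ Y μ →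
        (∀ k, HasLaw (δ k) (Dropout.dropoutLaw d p) μ) →
        iIndepFun δ μ →
        IndepFun (fun ω k => δ k ω) (fun ω => (Y ω, β₀ ω)) μ →
        Dropout.IsMarginalizedLossMinimizer X p b →
        ∀ k : ℕ, 1 ≤ k →
          ‖Dropout.covMatrix
                (fun ω => Dropout.dropoutIterate X α (Y ω) (β₀ ω) (fun j => δ j ω) k) μ
              - Dropout.covMatrix (fun ω => b (Y ω)) μ‖
            ≤ (k * ‖1 - (α * p) • Dropout.offDiagScale p (Dropout.gram X)‖ ^ (k - 1) * C'
                + α * p * C'') / (1 - p) ^ 2 ∧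
          ‖Dropout.covMatrix
                (fun ω => Dropout.dropoutIterate X α (Y ω) (β₀ ω) (fun j => δ j ω) k) μ
              - (Dropout.diagPart (Dropout.gram X))⁻¹ * Dropout.gram X
                * (Dropout.diagPart (Dropout.gram X))⁻¹‖
            ≤ (k * ‖1 - (α * p) • Dropout.offDiagScale p (Dropout.gram X)‖ ^ (k - 1) * C'
                + p * (1 + α) * C'') / (1 - p) ^ 2 := by
  obtain ⟨C', C'', hC⟩ := mainTheorem7_general X hX βstar ν hν_sq hν_cov π hπ_sq
  refine ⟨C', C'', fun α p hα hp₀ hp₁ _ hαX Ω _ μ _ ε Y β₀ δ b hε hYε hβ _ =>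
    hC α p hα hp₀ hp₁ ?_ Ω μ ε Y β₀ δ b hε hYε hβ⟩
  rw [mul_comm, ← div_div] at hαX
  linarith
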